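/- Let $k$ be a field of characteristic zero, let $H$ be a finite group and let $\alpha\in Z^3(H,k^*)$ be a normalised 3-cocycle, i.e. $\alpha(g,h,l)\,\alpha(f,gh,l)\,\alpha(f,g,h)=\alpha(fg,h,l)\,\alpha(f,g,hl)$ and $\alpha(f,g,h)=1$ whenever one of $f,g,h$ is the identity $e$ (for instance, $H$ is a subgroup of a finite group $G$ and $\alpha$ is the restriction to $H$ of a normalised 3-cocycle on $G$). Put $$\alpha(f,g|h)=\alpha(f,g,h)^{-1}\alpha(f,ghg^{-1},g)\,\alpha(fgh(fg)^{-1},f,g)^{-1},\qquad \alpha(f|g,h)=\alpha(f,g,h)\,\alpha(fgf^{-1},f,h)^{-1}\alpha(fgf^{-1},fhf^{-1},f).$$ Let $\mathcal Z(H,\alpha)$ be the following braided monoidal category. Its objects are finite-dimensional $H$-graded $k$-vector spaces $V=\bigoplus_{h\in H}V_h$ with linear automorphisms $v\mapsto f.v$ ($f\in H$) such that $f.V_g=V_{fgf^{-1}}$ and $(fg).v=\alpha(f,g|h)\,f.(g.v)$ for $v\in V_h$; morphisms are the linear maps preserving the grading and the action. The tensor product is the graded tensor product with $f.(x\otimes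 y)=\alpha(f|g,h)\,(f.x\otimes f.y)$ for $x\in X_g$, $y\in Y_h$; the unit is $k$ in degree $e$ with trivial action; the associativity constraint is $u\otimes(v\otimes w)\mapsto\alpha(f,g,h)\,(u\otimes v)\otimes w$ for $u\in U_f$, $v\in V_g$, $w\in W_h$; the braiding is $x\otimes y\mapsto f.y\otimes x$ for $x\in X_f$. Let $F\trianglelefteq H$ be a normal subgroup and let $\gamma:F\times F\to k^*$ and $\varepsilon:H\times F\to k^*$, $(h,f)\mapsto\varepsilon_h(f)$, satisfy, for all $f,f',f''\in F$ and $g,h\in H$, $$\gamma(f',f'')\,\gamma(ff',f'')^{-1}\,\gamma(f,f'f'')\,\gamma(f,f')^{-1}=\alpha(f,f',f''),\qquad \varepsilon_{gh}(f)=\alpha(g,h|f)\,\varepsilon_g(hfh^{-1})\,\varepsilon_h(f),$$ $$\gamma(f,f')\,\varepsilon_h(ff')=\alpha(h|f,f')\,\varepsilon_h(f)\,\varepsilon_h(f')\,\gamma(hfh^{-1},hf'h^{-1}),\qquad \gamma(f,f')=\varepsilon_f(f')\,\gamma(ff'f^{-1},f).$$ Let $k[F,\gamma,\varepsilon]$ be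 the corresponding etale (indecomposable, commutative, separable) algebra in $\mathcal Z(H,\alpha)$: it has a basis $e_f$ ($f\in F$) with $e_f$ of degree $f$, action $h.e_f=\varepsilon_h(f)\,e_{hfh^{-1}}$, multiplication $e_fe_{f'}=\gamma(f,f')\,e_{ff'}$, and unit $\gamma(e,e)^{-1}e_e$. A commutative algebra $A$ in an additive braided monoidal category with braiding $c$ is called Lagrangian if every local right $A$-module is a direct sum of (finitely many, possibly zero) copies of the regular module $A$; here modules are unital, and a right module $\nu:M\otimes A\to M$ is local if $\nu\circ c_{A,M}\circ c_{M,A}=\nu$. Then $k[F,\gamma,\varepsilon]$ is Lagrangian in $\mathcal Z(H,\alpha)$ if and only if $F=H$. -/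

import Mathlib

open scoped TensorProduct

universe u v

/-- A normalised `3`-cocycle of `G` with values in the multiplicative group `kˣ`. -/
structure NormCocycle (k : Type*) [Field k] (G : Type*) [Group G] where
  toFun : G → G → G → kˣ
  cocycle : ∀ f g h l : G,
    toFun g h l * toFun f (g * h) l * toFun f g h = toFun (f * g) h l * toFun f g (h * l)
  one_left : ∀ g h : G, toFun 1 g h = 1
  one_mid : ∀ f h : G, toFun f 1 h = 1
  one_right : ∀ f g : G, toFun f g 1 = 1

namespace NormCocycle

variable {k : Type*} [Field k] {G : Type*} [Group G] (α : NormCocycle k G)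

/-- `α(f, g | h) = α(f, g, h)⁻¹ α(f, ghg⁻¹, g) α(fgh(fg)⁻¹, f, g)⁻¹`. -/
def actTwist (f g h : G) : kˣ :=
  (α.toFun f g h)⁻¹ * α.toFun f (g * h * g⁻¹) g * (α.toFun (f * g * h * (f * g)⁻¹) f g)⁻¹

/-- `α(f | g, h) = α(f, g, h) α(fgf⁻¹, f, h)⁻¹ α(fgf⁻¹, fhf⁻¹, f)`. -/
def tensorTwist (f g h : G) : kˣ :=
  α.toFun f g h * (α.toFun (f * g * f⁻¹) f h)⁻¹ *
    α.toFun (f * g * f⁻¹) (f * h * f⁻¹) f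

theorem actTwist_eq {f g h a b : G} (ha : a * g = g * h) (hb : b * f = f * a) :
    α.actTwist f g h = (α.toFun f g h)⁻¹ * α.toFun f a g * (α.toFun b f g)⁻¹ := by
  have e1 : g * h * g⁻¹ = a := by rw [← ha]; group
  have e2 : f * g * h * (f * g)⁻¹ = b := by
    have : b = f * a * f⁻¹ := by rw [← hb]; group
    rw [this, ← e1]; group
  rw [actTwist, e1, e2]

theorem tensorTwist_eq {f g h a b : G} (ha : a * f = f * g) (hb : b * f = f * h) :
    α.tensorTwist f g h = α.toFun f g h * (α.toFun a f h)⁻¹ * α.toFun a b f := by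
  have e1 : f * g * f⁻¹ = a := by rw [← ha]; group
  have e2 : f * h * f⁻¹ = b := by rw [← hb]; group
  rw [tensorTwist, e1, e2]

theorem val_cocycle (f g h l : G) :
    Additive.ofMul (α.toFun g h l) + Additive.ofMul (α.toFun f (g * h) l)
      + Additive.ofMul (α.toFun f g h)
      = Additive.ofMul (α.toFun (f * g) h l) + Additive.ofMul (α.toFun f g (h * l)) :=
  α.cocycle f g h l

@[simp] theorem actTwist_one_one (g : G) : α.actTwist 1 1 g = 1 := by
  simp [actTwist, α.one_left, α.one_mid, α.one_right]

@[simp] theorem actTwist_one (f g : G) : α.actTwist f g 1 = 1 := by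
  simp [actTwist, α.one_left, α.one_mid, α.one_right]

@[simp] theorem tensorTwist_one (g h : G) : α.tensorTwist 1 g h = 1 := by
  simp [tensorTwist, α.one_left, α.one_mid, α.one_right]

@[simp] theorem tensorTwist_one_left (f h : G) : α.tensorTwist f 1 h = 1 := by
  simp [tensorTwist, α.one_left, α.one_mid, α.one_right]

@[simp] theorem tensorTwist_one_right (f g : G) : α.tensorTwist f g 1 = 1 := by
  simp [tensorTwist, α.one_left, α.one_mid, α.one_right]

theorem actTwist_tensorTwist (f g u v : G) :
    α.tensorTwist (f * g) u v * (α.actTwist f g u * α.actTwist f g v) =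
      α.actTwist f g (u * v) * (α.tensorTwist g u v *
        α.tensorTwist f (g * u * g⁻¹) (g * v * g⁻¹)) := by
  obtain ⟨u1, hu1⟩ : ∃ x, x = g * u * g⁻¹ := ⟨_, rfl⟩
  obtain ⟨v1, hv1⟩ : ∃ x, x = g * v * g⁻¹ := ⟨_, rfl⟩
  obtain ⟨u2, hu2⟩ : ∃ x, x = f * u1 * f⁻¹ := ⟨_, rfl⟩
  obtain ⟨v2, hv2⟩ : ∃ x, x = f * v1 * f⁻¹ := ⟨_, rfl⟩
  have a1 : u1 * g = g * u := by rw [hu1]; group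
  have a2 : v1 * g = g * v := by rw [hv1]; group
  have a3 : u2 * f = f * u1 := by rw [hu2]; group
  have a4 : v2 * f = f * v1 := by rw [hv2]; group
  rw [← hu1, ← hv1,
    α.tensorTwist_eq (f := f * g) (g := u) (h := v) (a := u2) (b := v2)
      (by rw [← mul_assoc, a3, mul_assoc, a1, mul_assoc])
      (by rw [← mul_assoc, a4, mul_assoc, a2, mul_assoc]),
    α.actTwist_eq a1 a3, α.actTwist_eq a2 a4,
    α.actTwist_eq (f := f) (g := g) (h := u * v) (a := u1 * v1) (b := u2 * v2)
      (by rw [mul_assoc, a2, ← mul_assoc, a1, mul_assoc])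
      (by rw [mul_assoc, a4, ← mul_assoc, a3, mul_assoc]),
    α.tensorTwist_eq a1 a2, α.tensorTwist_eq a3 a4]
  have c1 := α.val_cocycle f g u v
  have c2 := α.val_cocycle f u1 g v
  have c3 := α.val_cocycle u2 f g v
  have c4 := α.val_cocycle f u1 v1 g
  have c5 := α.val_cocycle u2 f v1 g
  have c6 := α.val_cocycle u2 v2 f g
  apply Additive.ofMul.injective
  simp only [ofMul_mul, ofMul_inv]
  simp only [a1, a2, a3, a4] at c1 c2 c3 c4 c5 c6
  linear_combination (norm := abel) (-1 : ℤ) • c1 + c2 - c3 - c4 + c5 - c6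

theorem tensorTwist_assoc (f g h u : G) :
    α.toFun g h u * (α.tensorTwist f (g * h) u * α.tensorTwist f g h) =
      α.tensorTwist f g (h * u) * α.tensorTwist f h u *
        α.toFun (f * g * f⁻¹) (f * h * f⁻¹) (f * u * f⁻¹) := by
  obtain ⟨g1, hg1⟩ : ∃ x, x = f * g * f⁻¹ := ⟨_, rfl⟩
  obtain ⟨h1, hh1⟩ : ∃ x, x = f * h * f⁻¹ := ⟨_, rfl⟩
  obtain ⟨u1, hu1⟩ : ∃ x, x = f * u * f⁻¹ := ⟨_, rfl⟩
  have a1 : g1 * f = f * g := by rw [hg1]; group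
  have a2 : h1 * f = f * h := by rw [hh1]; group
  have a3 : u1 * f = f * u := by rw [hu1]; group
  rw [← hg1, ← hh1, ← hu1, α.tensorTwist_eq a1 a2, α.tensorTwist_eq a2 a3,
    α.tensorTwist_eq (f := f) (g := g * h) (h := u) (a := g1 * h1) (b := u1)
      (by rw [mul_assoc, a2, ← mul_assoc, a1, mul_assoc]) a3,
    α.tensorTwist_eq (f := f) (g := g) (h := h * u) (a := g1) (b := h1 * u1) a1
      (by rw [mul_assoc, a3, ← mul_assoc, a2, mul_assoc])]
  have c1 := α.val_cocycle f g h u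
  have c2 := α.val_cocycle g1 f h u
  have c3 := α.val_cocycle g1 h1 f u
  have c4 := α.val_cocycle g1 h1 u1 f
  apply Additive.ofMul.injective
  simp only [ofMul_mul, ofMul_inv]
  simp only [a1, a2, a3] at c1 c2 c3 c4
  linear_combination (norm := abel) c1 - c2 + c3 - c4

theorem actTwist_braid (g f h : G) :
    α.actTwist (g * f * g⁻¹) g h * α.tensorTwist g (f * h * f⁻¹) f =
      α.actTwist g f h * α.tensorTwist g f h := by
  obtain ⟨a, ha⟩ : ∃ x, x = f * h * f⁻¹ := ⟨_, rfl⟩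
  obtain ⟨b, hb⟩ : ∃ x, x = g * a * g⁻¹ := ⟨_, rfl⟩
  obtain ⟨h1, hh1⟩ : ∃ x, x = g * h * g⁻¹ := ⟨_, rfl⟩
  obtain ⟨f1, hf1⟩ : ∃ x, x = g * f * g⁻¹ := ⟨_, rfl⟩
  have a1 : a * f = f * h := by rw [ha]; group
  have a2 : b * g = g * a := by rw [hb]; group
  have a3 : h1 * g = g * h := by rw [hh1]; group
  have a4 : f1 * g = g * f := by rw [hf1]; group
  have a5 : b * f1 = f1 * h1 := by
    rw [← mul_left_inj g, mul_assoc, a4, ← mul_assoc, a2, mul_assoc, a1, mul_assoc, a3,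
      ← mul_assoc, ← mul_assoc, a4]
  rw [← ha, ← hf1, α.actTwist_eq a3 a5, α.actTwist_eq a1 a2, α.tensorTwist_eq a2 a4,
    α.tensorTwist_eq a4 a3]
  apply Additive.ofMul.injective
  simp only [ofMul_mul, ofMul_inv]
  abel

end NormCocycle

/-- An object of `𝒵(G, α)`: a finite-dimensional `G`-graded vector space with an `α`-projective
`G`-action.  The grading `V = ⨁ V_g` is recorded by the projections `pr g : V → V` onto the
homogeneous components, so `V_g = {v | pr g v = v}`.  Given `act_mul`, the condition `act 1 = 1`
says precisely that every `act f` is invertible. -/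
structure TwistedCenter (k : Type u) [Field k] (G : Type v) [Group G] [Fintype G]
    (α : NormCocycle k G) where
  carrier : Type (max u v)
  [addCommGroup : AddCommGroup carrier]
  [module : Module k carrier]
  [finite : Module.Finite k carrier]
  pr : G → Module.End k carrier
  pr_complete : CompleteOrthogonalIdempotents pr
  act : G → Module.End k carrier
  act_pr : ∀ (f g : G) (v : carrier), act f (pr g v) = pr (f * g * f⁻¹) (act f v)
  act_one : act 1 = 1
  act_mul : ∀ (f g h : G) (v : carrier),
    act (f * g) (pr h v) = (α.actTwist f g h : k) • act f (act g (pr h v))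

namespace TwistedCenter

variable {k : Type u} [Field k] {G : Type v} [Group G] [Fintype G] {α : NormCocycle k G}

attribute [instance] TwistedCenter.addCommGroup TwistedCenter.module TwistedCenter.finite

section Linear

variable (X Y Z W : TwistedCenter k G α)

theorem sum_pr (x : X.carrier) : ∑ g, X.pr g x = x := by
  have := congrArg (fun φ : Module.End k X.carrier => φ x) X.pr_complete.complete
  simpa [LinearMap.sum_apply] using this

theorem pr_pr (g : G) (x : X.carrier) : X.pr g (X.pr g x) = X.pr g x :=
  congrArg (fun φ : Module.End k X.carrier => φ x) (X.pr_complete.idem g)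

variable {X Y Z W}

theorem pr_ne {g h : G} {x : X.carrier} (hx : X.pr g x = x) (hn : h ≠ g) : X.pr h x = 0 := by
  rw [← hx]
  exact congrArg (fun φ : Module.End k X.carrier => φ x) (X.pr_complete.ortho hn)

theorem act_homog (f : G) {g : G} {x : X.carrier} (hx : X.pr g x = x) :
    X.pr (f * g * f⁻¹) (X.act f x) = X.act f x := by
  rw [← X.act_pr, hx]

theorem act_mul_homog (f g : G) {h : G} {x : X.carrier} (hx : X.pr h x = x) :
    X.act (f * g) x = (α.actTwist f g h : k) • X.act f (X.act g x) := by
  have := X.act_mul f g h x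
  rwa [hx] at this

theorem lin_ext {M : Type*} [AddCommGroup M] [Module k M] {φ ψ : X.carrier →ₗ[k] M}
    (h : ∀ (g : G) (x : X.carrier), X.pr g x = x → φ x = ψ x) : φ = ψ := by
  ext x
  rw [← X.sum_pr x, map_sum, map_sum]
  exact Finset.sum_congr rfl fun g _ => h g _ (X.pr_pr g x)

theorem lin_ext₂ {M : Type*} [AddCommGroup M] [Module k M]
    {φ ψ : X.carrier ⊗[k] Y.carrier →ₗ[k] M}
    (h : ∀ (f g : G) (x : X.carrier) (y : Y.carrier), X.pr f x = x → Y.pr g y = y →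
      φ (x ⊗ₜ y) = ψ (x ⊗ₜ y)) : φ = ψ :=
  TensorProduct.ext <| lin_ext fun f x hx => lin_ext fun g y hy => h f g x y hx hy

theorem lin_ext₃ {M : Type*} [AddCommGroup M] [Module k M]
    {φ ψ : (X.carrier ⊗[k] Y.carrier) ⊗[k] Z.carrier →ₗ[k] M}
    (h : ∀ (f g h : G) (x : X.carrier) (y : Y.carrier) (z : Z.carrier),
      X.pr f x = x → Y.pr g y = y → Z.pr h z = z →
      φ ((x ⊗ₜ y) ⊗ₜ z) = ψ ((x ⊗ₜ y) ⊗ₜ z)) : φ = ψ :=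
  TensorProduct.ext <| lin_ext₂ fun f g x y hx hy => lin_ext fun l z hz => h f g l x y z hx hy hz

theorem lin_ext₃' {M : Type*} [AddCommGroup M] [Module k M]
    {φ ψ : X.carrier ⊗[k] (Y.carrier ⊗[k] Z.carrier) →ₗ[k] M}
    (h : ∀ (f g h : G) (x : X.carrier) (y : Y.carrier) (z : Z.carrier),
      X.pr f x = x → Y.pr g y = y → Z.pr h z = z →
      φ (x ⊗ₜ (y ⊗ₜ z)) = ψ (x ⊗ₜ (y ⊗ₜ z))) : φ = ψ :=
  TensorProduct.ext <| lin_ext fun f x hx => lin_ext₂ fun g l y z hy hz => h f g l x y z hx hy hz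

variable (X Y Z W)

/-- The projections of `X ⊗ Y`: `(X ⊗ Y)_f = ⨁_{gh = f} X_g ⊗ Y_h`. -/
noncomputable def tensorPr (f : G) : Module.End k (X.carrier ⊗[k] Y.carrier) :=
  ∑ g, TensorProduct.map (X.pr g) (Y.pr (g⁻¹ * f))

/-- The action on `X ⊗ Y`: `f.(x ⊗ y) = α(f | g, h) (f.x ⊗ f.y)` for `x ∈ X_g`, `y ∈ Y_h`. -/
noncomputable def tensorAct (f : G) : Module.End k (X.carrier ⊗[k] Y.carrier) :=
  ∑ g, ∑ h, (α.tensorTwist f g h : k) •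
    TensorProduct.map (X.act f ∘ₗ X.pr g) (Y.act f ∘ₗ Y.pr h)

/-- `(x ⊗ y) ⊗ z ↦ α(f, g, h)⁻¹ x ⊗ (y ⊗ z)` for `x ∈ X_f`, `y ∈ Y_g`, `z ∈ Z_h`. -/
noncomputable def assocLin : (X.carrier ⊗[k] Y.carrier) ⊗[k] Z.carrier →ₗ[k]
    X.carrier ⊗[k] (Y.carrier ⊗[k] Z.carrier) :=
  ∑ f, ∑ g, ∑ h, (((α.toFun f g h)⁻¹ : kˣ) : k) •
    ((TensorProduct.assoc k X.carrier Y.carrier Z.carrier).toLinearMap ∘ₗ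
      TensorProduct.map (TensorProduct.map (X.pr f) (Y.pr g)) (Z.pr h))

/-- `x ⊗ (y ⊗ z) ↦ α(f, g, h) (x ⊗ y) ⊗ z` for `x ∈ X_f`, `y ∈ Y_g`, `z ∈ Z_h`. -/
noncomputable def assocInvLin : X.carrier ⊗[k] (Y.carrier ⊗[k] Z.carrier) →ₗ[k]
    (X.carrier ⊗[k] Y.carrier) ⊗[k] Z.carrier :=
  ∑ f, ∑ g, ∑ h, (α.toFun f g h : k) •
    ((TensorProduct.assoc k X.carrier Y.carrier Z.carrier).symm.toLinearMap ∘ₗ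
      TensorProduct.map (X.pr f) (TensorProduct.map (Y.pr g) (Z.pr h)))

/-- The braiding `x ⊗ y ↦ f.y ⊗ x` for `x ∈ X_f`. -/
noncomputable def braidLin : X.carrier ⊗[k] Y.carrier →ₗ[k] Y.carrier ⊗[k] X.carrier :=
  ∑ f, TensorProduct.map (Y.act f) (X.pr f) ∘ₗ (TensorProduct.comm k X.carrier Y.carrier).toLinearMap

/-- The inverse of the operator `act f`. -/
noncomputable def actInv (f : G) : Module.End k X.carrier :=
  ∑ h, (α.actTwist f⁻¹ f (f⁻¹ * h * f) : k) • (X.act f⁻¹ ∘ₗ X.pr h)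

/-- The inverse braiding `y ⊗ x ↦ x ⊗ f⁻¹(y)` for `x ∈ X_f`. -/
noncomputable def braidInvLin : Y.carrier ⊗[k] X.carrier →ₗ[k] X.carrier ⊗[k] Y.carrier :=
  ∑ f, (TensorProduct.comm k Y.carrier X.carrier).toLinearMap ∘ₗ
    TensorProduct.map (Y.actInv f) (X.pr f)

variable {X Y Z W}

theorem tensorPr_tmul {g h : G} {x : X.carrier} {y : Y.carrier} (hx : X.pr g x = x)
    (hy : Y.pr h y = y) : tensorPr X Y (g * h) (x ⊗ₜ y) = x ⊗ₜ y := by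
  rw [tensorPr, LinearMap.sum_apply, Finset.sum_eq_single g]
  · simp [hx, hy]
  · intro b _ hb
    simp [pr_ne hx hb]
  · simp

theorem tensorPr_tmul_ne {f g h : G} {x : X.carrier} {y : Y.carrier} (hx : X.pr g x = x)
    (hy : Y.pr h y = y) (hf : f ≠ g * h) : tensorPr X Y f (x ⊗ₜ y) = 0 := by
  rw [tensorPr, LinearMap.sum_apply, Finset.sum_eq_zero]
  intro b _
  by_cases hb : b = g
  · subst hb
    have : b⁻¹ * f ≠ h := by
      rintro rfl
      exact hf (by group)
    simp [pr_ne hy this]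
  · simp [pr_ne hx hb]

theorem tensorAct_tmul (f : G) {g h : G} {x : X.carrier} {y : Y.carrier} (hx : X.pr g x = x)
    (hy : Y.pr h y = y) :
    tensorAct X Y f (x ⊗ₜ y) = (α.tensorTwist f g h : k) • (X.act f x ⊗ₜ Y.act f y) := by
  rw [tensorAct, LinearMap.sum_apply, Finset.sum_eq_single g]
  · rw [LinearMap.sum_apply, Finset.sum_eq_single h]
    · simp [hx, hy]
    · intro b _ hb
      simp [pr_ne hy hb]
    · simp
  · intro b _ hb
    simp [pr_ne hx hb, LinearMap.sum_apply]
  · simp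

theorem assocLin_tmul {f g h : G} {x : X.carrier} {y : Y.carrier} {z : Z.carrier}
    (hx : X.pr f x = x) (hy : Y.pr g y = y) (hz : Z.pr h z = z) :
    assocLin X Y Z ((x ⊗ₜ y) ⊗ₜ z) = (((α.toFun f g h)⁻¹ : kˣ) : k) • (x ⊗ₜ (y ⊗ₜ z)) := by
  rw [assocLin, LinearMap.sum_apply, Finset.sum_eq_single f]
  · rw [LinearMap.sum_apply, Finset.sum_eq_single g]
    · rw [LinearMap.sum_apply, Finset.sum_eq_single h]
      · simp [hx, hy, hz]
      · intro b _ hb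
        simp [pr_ne hz hb]
      · simp
    · intro b _ hb
      simp [pr_ne hy hb, LinearMap.sum_apply]
    · simp
  · intro b _ hb
    simp [pr_ne hx hb, LinearMap.sum_apply]
  · simp

theorem assocInvLin_tmul {f g h : G} {x : X.carrier} {y : Y.carrier} {z : Z.carrier}
    (hx : X.pr f x = x) (hy : Y.pr g y = y) (hz : Z.pr h z = z) :
    assocInvLin X Y Z (x ⊗ₜ (y ⊗ₜ z)) = (α.toFun f g h : k) • ((x ⊗ₜ y) ⊗ₜ z) := by
  rw [assocInvLin, LinearMap.sum_apply, Finset.sum_eq_single f]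
  · rw [LinearMap.sum_apply, Finset.sum_eq_single g]
    · rw [LinearMap.sum_apply, Finset.sum_eq_single h]
      · simp [hx, hy, hz]
      · intro b _ hb
        simp [pr_ne hz hb]
      · simp
    · intro b _ hb
      simp [pr_ne hy hb, LinearMap.sum_apply]
    · simp
  · intro b _ hb
    simp [pr_ne hx hb, LinearMap.sum_apply]
  · simp

theorem braidLin_tmul {f : G} {x : X.carrier} (hx : X.pr f x = x) (y : Y.carrier) :
    braidLin X Y (x ⊗ₜ y) = Y.act f y ⊗ₜ x := by
  rw [braidLin, LinearMap.sum_apply, Finset.sum_eq_single f]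
  · simp [hx]
  · intro b _ hb
    simp [pr_ne hx hb]
  · simp

theorem braidInvLin_tmul {f : G} {x : X.carrier} (hx : X.pr f x = x) (y : Y.carrier) :
    braidInvLin X Y (y ⊗ₜ x) = x ⊗ₜ Y.actInv f y := by
  rw [braidInvLin, LinearMap.sum_apply, Finset.sum_eq_single f]
  · simp [hx]
  · intro b _ hb
    simp [pr_ne hx hb]
  · simp

theorem actInv_act (f : G) (x : X.carrier) : X.actInv f (X.act f x) = x := by
  suffices h : X.actInv f ∘ₗ X.act f = LinearMap.id from
    congrArg (fun φ : Module.End k X.carrier => φ x) h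
  refine lin_ext fun g x hx => ?_
  have h1 := act_homog f hx
  rw [LinearMap.comp_apply, actInv, LinearMap.sum_apply, Finset.sum_eq_single (f * g * f⁻¹)]
  · have h2 : f⁻¹ * (f * g * f⁻¹) * f = g := by group
    rw [h2, LinearMap.smul_apply, LinearMap.comp_apply, h1, ← act_mul_homog _ _ hx,
      inv_mul_cancel, act_one]
    rfl
  · intro b _ hb
    simp [pr_ne h1 hb]
  · simp

theorem act_actInv (f : G) (x : X.carrier) : X.act f (X.actInv f x) = x := by
  have h : X.actInv f * X.act f = 1 := LinearMap.ext (actInv_act f)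
  exact congrArg (fun φ : Module.End k X.carrier => φ x) (mul_eq_one_comm.mp h)

variable (X Y)

/-- The tensor product of objects. -/
noncomputable abbrev tensorObj : TwistedCenter k G α where
  carrier := X.carrier ⊗[k] Y.carrier
  pr := tensorPr X Y
  pr_complete := by
    classical
    have key : ∀ f f' : G, tensorPr X Y f * tensorPr X Y f' =
        if f = f' then tensorPr X Y f' else 0 := by
      intro f f'
      refine lin_ext₂ fun g h x y hx hy => ?_
      rw [Module.End.mul_apply]
      by_cases h1 : f' = g * h
      · subst h1
        rw [tensorPr_tmul hx hy]
        split_ifs with h2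
        · subst h2; rfl
        · rw [tensorPr_tmul_ne hx hy h2]; rfl
      · rw [tensorPr_tmul_ne hx hy h1, map_zero]
        split_ifs with h2
        · rw [tensorPr_tmul_ne hx hy h1]
        · rfl
    refine ⟨⟨fun f => ?_, fun f f' hf => ?_⟩, ?_⟩
    · exact (key f f).trans (if_pos rfl)
    · exact (key f f').trans (if_neg hf)
    · refine lin_ext₂ fun g h x y hx hy => ?_
      rw [LinearMap.sum_apply, Finset.sum_eq_single (g * h)]
      · rw [tensorPr_tmul hx hy]; rfl
      · intro b _ hb
        exact tensorPr_tmul_ne hx hy hb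
      · simp
  act := tensorAct X Y
  act_pr := by
    intro f g v
    suffices h : tensorAct X Y f ∘ₗ tensorPr X Y g =
        tensorPr X Y (f * g * f⁻¹) ∘ₗ tensorAct X Y f from
      congrArg (fun φ : Module.End k _ => φ v) h
    refine lin_ext₂ fun a b x y hx hy => ?_
    rw [LinearMap.comp_apply, LinearMap.comp_apply, tensorAct_tmul f hx hy, map_smul]
    have h1 := act_homog f hx
    have h2 := act_homog f hy
    by_cases hg : g = a * b
    · subst hg
      have : f * (a * b) * f⁻¹ = (f * a * f⁻¹) * (f * b * f⁻¹) := by group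
      rw [this, tensorPr_tmul h1 h2, tensorPr_tmul hx hy, tensorAct_tmul f hx hy]
    · have : f * g * f⁻¹ ≠ (f * a * f⁻¹) * (f * b * f⁻¹) := by
        intro e
        apply hg
        have e' : f * g * f⁻¹ = f * (a * b) * f⁻¹ := by rw [e]; group
        exact mul_left_cancel (mul_right_cancel e')
      rw [tensorPr_tmul_ne h1 h2 this, tensorPr_tmul_ne hx hy hg, map_zero, smul_zero]
  act_one := by
    refine lin_ext₂ fun a b x y hx hy => ?_
    rw [tensorAct_tmul 1 hx hy]
    simp [act_one]
  act_mul := by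
    intro f g h v
    suffices e : tensorAct X Y (f * g) ∘ₗ tensorPr X Y h =
        (α.actTwist f g h : k) • (tensorAct X Y f ∘ₗ tensorAct X Y g ∘ₗ tensorPr X Y h) from
      congrArg (fun φ : Module.End k _ => φ v) e
    refine lin_ext₂ fun a b x y hx hy => ?_
    simp only [LinearMap.comp_apply, LinearMap.smul_apply]
    by_cases hh : h = a * b
    · subst hh
      rw [tensorPr_tmul hx hy, tensorAct_tmul _ hx hy, tensorAct_tmul _ hx hy, map_smul,
        tensorAct_tmul _ (act_homog g hx) (act_homog g hy), act_mul_homog f g hx,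
        act_mul_homog f g hy, TensorProduct.smul_tmul_smul]
      simp only [smul_smul]
      congr 1
      exact_mod_cast congrArg Units.val (α.actTwist_tensorTwist f g a b)
    · rw [tensorPr_tmul_ne hx hy hh]
      simp

/-- The monoidal unit: the one-dimensional space `k` in degree `1` with trivial action. -/
noncomputable abbrev unitObj (α : NormCocycle k G) : TwistedCenter k G α where
  carrier := ULift.{v} k
  pr := open Classical in fun g => if g = 1 then 1 else 0
  pr_complete := by
    classical
    refine ⟨⟨fun f => ?_, fun f f' hf => ?_⟩, ?_⟩
    · show _ * _ = _
      split_ifs <;> simp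
    · show _ * _ = _
      split_ifs with h1 h2
      · exact absurd (h1.trans h2.symm) hf
      all_goals simp
    · simp
  act := fun _ => 1
  act_pr := by
    intro f g v
    by_cases hg : g = 1 <;> simp [hg]
  act_one := rfl
  act_mul := by
    intro f g h v
    by_cases hh : h = 1
    · subst hh; simp
    · simp [hh]

end Linear

end TwistedCenter

namespace TwistedCenter

variable {k : Type u} [Field k] {G : Type v} [Group G] [Fintype G] {α : NormCocycle k G}

open CategoryTheory

/-- Morphisms of `𝒵(G, α)`: linear maps preserving the grading and the action. -/
@[ext]
structure Hom (X Y : TwistedCenter k G α) where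
  lin : X.carrier →ₗ[k] Y.carrier
  lin_pr : ∀ (g : G) (x : X.carrier), lin (X.pr g x) = Y.pr g (lin x)
  lin_act : ∀ (g : G) (x : X.carrier), lin (X.act g x) = Y.act g (lin x)

instance : Category (TwistedCenter k G α) where
  Hom X Y := Hom X Y
  id X := ⟨LinearMap.id, fun _ _ => rfl, fun _ _ => rfl⟩
  comp φ ψ := ⟨ψ.lin ∘ₗ φ.lin,
    fun g x => by simp [φ.lin_pr, ψ.lin_pr], fun g x => by simp [φ.lin_act, ψ.lin_act]⟩

section

variable {X Y Z W X' Y' Z' : TwistedCenter k G α}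

theorem hom_ext {φ ψ : X ⟶ Y} (h : φ.lin = ψ.lin) : φ = ψ := Hom.ext h

@[simp] theorem id_lin : Hom.lin (𝟙 X) = LinearMap.id := rfl

@[simp] theorem comp_lin (φ : X ⟶ Y) (ψ : Y ⟶ Z) : (φ ≫ ψ).lin = ψ.lin ∘ₗ φ.lin := rfl

theorem lin_homog (φ : X ⟶ Y) {g : G} {x : X.carrier} (hx : X.pr g x = x) :
    Y.pr g (φ.lin x) = φ.lin x := by
  rw [← φ.lin_pr, hx]

theorem tensor_homog {g h : G} {x : X.carrier} {y : Y.carrier} (hx : X.pr g x = x)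
    (hy : Y.pr h y = y) : (tensorObj X Y).pr (g * h) (x ⊗ₜ y) = x ⊗ₜ y :=
  tensorPr_tmul hx hy

theorem pr_of_homog (φ : X.carrier →ₗ[k] Y.carrier)
    (h : ∀ (g : G) (x : X.carrier), X.pr g x = x → Y.pr g (φ x) = φ x) (g : G) (x : X.carrier) :
    φ (X.pr g x) = Y.pr g (φ x) := by
  suffices e : φ ∘ₗ X.pr g = Y.pr g ∘ₗ φ from
    congrArg (fun ψ : X.carrier →ₗ[k] Y.carrier => ψ x) e
  refine lin_ext fun a x hx => ?_
  simp only [LinearMap.comp_apply]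
  by_cases ha : g = a
  · subst ha
    rw [hx, h _ _ hx]
  · rw [pr_ne hx ha, pr_ne (h _ _ hx) ha, map_zero]

theorem pr_of_homog₂ (φ : X.carrier ⊗[k] Y.carrier →ₗ[k] Z.carrier)
    (h : ∀ (f g : G) (x : X.carrier) (y : Y.carrier), X.pr f x = x → Y.pr g y = y →
      Z.pr (f * g) (φ (x ⊗ₜ y)) = φ (x ⊗ₜ y)) (g : G) (t : X.carrier ⊗[k] Y.carrier) :
    φ (tensorPr X Y g t) = Z.pr g (φ t) := by
  suffices e : φ ∘ₗ tensorPr X Y g = Z.pr g ∘ₗ φ from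
    congrArg (fun ψ : X.carrier ⊗[k] Y.carrier →ₗ[k] Z.carrier => ψ t) e
  refine lin_ext₂ fun a b x y hx hy => ?_
  simp only [LinearMap.comp_apply]
  by_cases ha : g = a * b
  · subst ha
    rw [tensorPr_tmul hx hy, h _ _ _ _ hx hy]
  · rw [tensorPr_tmul_ne hx hy ha, pr_ne (h _ _ _ _ hx hy) ha, map_zero]

theorem act_of_homog₂ (φ : X.carrier ⊗[k] Y.carrier →ₗ[k] Z.carrier)
    (h : ∀ (f a b : G) (x : X.carrier) (y : Y.carrier), X.pr a x = x → Y.pr b y = y →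
      (α.tensorTwist f a b : k) • φ (X.act f x ⊗ₜ Y.act f y) = Z.act f (φ (x ⊗ₜ y)))
    (f : G) (t : X.carrier ⊗[k] Y.carrier) :
    φ (tensorAct X Y f t) = Z.act f (φ t) := by
  suffices e : φ ∘ₗ tensorAct X Y f = Z.act f ∘ₗ φ from
    congrArg (fun ψ : X.carrier ⊗[k] Y.carrier →ₗ[k] Z.carrier => ψ t) e
  refine lin_ext₂ fun a b x y hx hy => ?_
  simp only [LinearMap.comp_apply]
  rw [tensorAct_tmul f hx hy, map_smul, h f a b x y hx hy]

/-- A morphism with a linear inverse is an isomorphism. -/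
def isoOfLin (φ : X ⟶ Y) (ψ : Y.carrier →ₗ[k] X.carrier) (h₁ : ψ ∘ₗ φ.lin = LinearMap.id)
    (h₂ : φ.lin ∘ₗ ψ = LinearMap.id) : X ≅ Y where
  hom := φ
  inv :=
    { lin := ψ
      lin_pr := fun g y => by
        have e₁ : ∀ x, ψ (φ.lin x) = x := fun x => congrArg (fun θ => θ x) h₁
        have e₂ : ∀ x, φ.lin (ψ x) = x := fun x => congrArg (fun θ => θ x) h₂
        rw [← e₁ (X.pr g (ψ y)), φ.lin_pr, e₂]
      lin_act := fun g y => by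
        have e₁ : ∀ x, ψ (φ.lin x) = x := fun x => congrArg (fun θ => θ x) h₁
        have e₂ : ∀ x, φ.lin (ψ x) = x := fun x => congrArg (fun θ => θ x) h₂
        rw [← e₁ (X.act g (ψ y)), φ.lin_act, e₂] }
  hom_inv_id := hom_ext h₁
  inv_hom_id := hom_ext h₂

/-- The tensor product of morphisms. -/
noncomputable def tensorHom (φ : X ⟶ X') (ψ : Y ⟶ Y') : tensorObj X Y ⟶ tensorObj X' Y' where
  lin := TensorProduct.map φ.lin ψ.lin
  lin_pr := pr_of_homog₂ (Z := tensorObj X' Y') _ fun _ _ _ _ hx hy =>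
    tensor_homog (lin_homog φ hx) (lin_homog ψ hy)
  lin_act := act_of_homog₂ (Z := tensorObj X' Y') _ fun f a b x y hx hy => by
    rw [TensorProduct.map_tmul, TensorProduct.map_tmul, φ.lin_act, ψ.lin_act]
    exact (tensorAct_tmul f (lin_homog φ hx) (lin_homog ψ hy)).symm

variable (X Y Z W)

/-- The associativity isomorphism. -/
noncomputable def associator : tensorObj (tensorObj X Y) Z ≅ tensorObj X (tensorObj Y Z) :=
  isoOfLin
    { lin := assocLin X Y Z
      lin_pr := by
        intro g t
        suffices e : assocLin X Y Z ∘ₗ tensorPr (tensorObj X Y) Z g =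
            tensorPr X (tensorObj Y Z) g ∘ₗ assocLin X Y Z from
          congrArg (fun θ => θ t) e
        refine lin_ext₃ fun a b c x y z hx hy hz => ?_
        simp only [LinearMap.comp_apply]
        by_cases hg : g = a * b * c
        · rw [hg, tensorPr_tmul (tensor_homog hx hy) hz, assocLin_tmul hx hy hz, map_smul,
            mul_assoc, tensorPr_tmul hx (tensor_homog hy hz)]
        · rw [tensorPr_tmul_ne (tensor_homog hx hy) hz hg, assocLin_tmul hx hy hz, map_smul,
            tensorPr_tmul_ne hx (tensor_homog hy hz) (by rwa [← mul_assoc]), map_zero, smul_zero]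
      lin_act := by
        intro g t
        suffices e : assocLin X Y Z ∘ₗ tensorAct (tensorObj X Y) Z g =
            tensorAct X (tensorObj Y Z) g ∘ₗ assocLin X Y Z from
          congrArg (fun θ => θ t) e
        refine lin_ext₃ fun a b c x y z hx hy hz => ?_
        simp only [LinearMap.comp_apply]
        rw [tensorAct_tmul g (tensor_homog hx hy) hz, tensorAct_tmul g hx hy,
          assocLin_tmul hx hy hz, map_smul, map_smul, tensorAct_tmul g hx (tensor_homog hy hz),
          tensorAct_tmul g hy hz, ← TensorProduct.smul_tmul', map_smul,
          assocLin_tmul (act_homog g hx) (act_homog g hy) (act_homog g hz), TensorProduct.tmul_smul]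
        simp only [smul_smul]
        congr 1
        have key : ∀ A B C D E F : kˣ, A * (B * C) = D * E * F →
            B * (C * F⁻¹) = A⁻¹ * (D * E) := by
          intro A B C D E F h
          rw [eq_inv_mul_iff_mul_eq, ← mul_assoc B C, ← mul_assoc A, h, mul_inv_cancel_right]
        exact_mod_cast congrArg Units.val (key _ _ _ _ _ _ (α.tensorTwist_assoc g a b c)) }
    (assocInvLin X Y Z)
    (by
      refine lin_ext₃ fun a b c x y z hx hy hz => ?_
      simp only [LinearMap.comp_apply]
      rw [assocLin_tmul hx hy hz, map_smul, assocInvLin_tmul hx hy hz, smul_smul]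
      simp)
    (by
      refine lin_ext₃' fun a b c x y z hx hy hz => ?_
      simp only [LinearMap.comp_apply]
      rw [assocInvLin_tmul hx hy hz, map_smul, assocLin_tmul hx hy hz, smul_smul]
      simp)

theorem eq_or_zero_of_homog {g : G} {c : (unitObj α).carrier} (hc : (unitObj α).pr g c = c) :
    g = 1 ∨ c = 0 := by
  by_cases hg : g = 1
  · exact Or.inl hg
  · refine Or.inr ?_
    rw [← hc]
    simp [hg]

/-- The left unit isomorphism. -/
noncomputable def leftUnitor : tensorObj (unitObj α) X ≅ X :=
  isoOfLin
    { lin := (TensorProduct.lid k X.carrier).toLinearMap ∘ₗ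
        TensorProduct.map ULift.moduleEquiv.toLinearMap LinearMap.id
      lin_pr := pr_of_homog₂ (X := unitObj α) _ fun f g c x hc hx => by
        rcases eq_or_zero_of_homog hc with rfl | rfl
        · simp [hx]
        · simp
      lin_act := act_of_homog₂ (X := unitObj α) _ fun f a b c x hc hx => by
        rcases eq_or_zero_of_homog hc with rfl | rfl
        · simp
        · simp }
    (TensorProduct.map ULift.moduleEquiv.symm.toLinearMap LinearMap.id ∘ₗ
      (TensorProduct.lid k X.carrier).symm.toLinearMap)
    (by
      ext c x
      simp [TensorProduct.smul_tmul']) (by ext; simp)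

/-- The right unit isomorphism. -/
noncomputable def rightUnitor : tensorObj X (unitObj α) ≅ X :=
  isoOfLin
    { lin := (TensorProduct.rid k X.carrier).toLinearMap ∘ₗ
        TensorProduct.map LinearMap.id ULift.moduleEquiv.toLinearMap
      lin_pr := pr_of_homog₂ (Y := unitObj α) _ fun f g x c hx hc => by
        rcases eq_or_zero_of_homog hc with rfl | rfl
        · simp [hx]
        · simp
      lin_act := act_of_homog₂ (Y := unitObj α) _ fun f a b x c hx hc => by
        rcases eq_or_zero_of_homog hc with rfl | rfl
        · simp
        · simp }
    (TensorProduct.map LinearMap.id ULift.moduleEquiv.symm.toLinearMap ∘ₗ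
      (TensorProduct.rid k X.carrier).symm.toLinearMap)
    (by
      ext x c
      simp [← TensorProduct.tmul_smul]) (by ext; simp)

/-- The braiding isomorphism. -/
noncomputable def braidIso : tensorObj X Y ≅ tensorObj Y X :=
  isoOfLin
    { lin := braidLin X Y
      lin_pr := pr_of_homog₂ (Z := tensorObj Y X) _ fun f g x y hx hy => by
        rw [braidLin_tmul hx]
        have e : f * g = (f * g * f⁻¹) * f := by group
        rw [e]
        exact tensor_homog (act_homog f hy) hx
      lin_act := act_of_homog₂ (Z := tensorObj Y X) _ fun f a b x y hx hy => by
        rw [braidLin_tmul hx, braidLin_tmul (act_homog f hx)]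
        refine Eq.trans ?_ (tensorAct_tmul f (act_homog a hy) hx).symm
        have e1 := act_mul_homog (f * a * f⁻¹) f hy
        rw [show f * a * f⁻¹ * f = f * a by group, act_mul_homog f a hy] at e1
        have e2 : Y.act (f * a * f⁻¹) (Y.act f y) =
            (((α.actTwist (f * a * f⁻¹) f b)⁻¹ * α.actTwist f a b : kˣ) : k) •
              Y.act f (Y.act a y) := by
          rw [Units.val_mul, ← smul_smul, e1, smul_smul]
          simp
        rw [e2, ← TensorProduct.smul_tmul', smul_smul]
        congr 1
        have key : ∀ A B C D : kˣ, A * B = C * D → D * (A⁻¹ * C) = B := by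
          intro A B C D h
          rw [mul_comm, mul_assoc, ← h, inv_mul_cancel_left]
        exact_mod_cast congrArg Units.val (key _ _ _ _ (α.actTwist_braid f a b)) }
    (braidInvLin X Y)
    (by
      refine lin_ext₂ fun a b x y hx hy => ?_
      simp only [LinearMap.comp_apply]
      rw [braidLin_tmul hx, braidInvLin_tmul hx, actInv_act]
      rfl)
    (by
      refine lin_ext₂ fun a b y x hy hx => ?_
      simp only [LinearMap.comp_apply]
      rw [braidInvLin_tmul hx, braidLin_tmul hx, act_actInv]
      rfl)

end

end TwistedCenter

namespace TwistedCenter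

variable {k : Type u} [Field k] {G : Type v} [Group G] [Fintype G] {α : NormCocycle k G}

open CategoryTheory MonoidalCategory

noncomputable instance : MonoidalCategoryStruct (TwistedCenter k G α) where
  tensorObj := tensorObj
  whiskerLeft X _ _ φ := tensorHom (𝟙 X) φ
  whiskerRight φ Y := tensorHom φ (𝟙 Y)
  tensorHom := tensorHom
  tensorUnit := unitObj α
  associator := associator
  leftUnitor := leftUnitor
  rightUnitor := rightUnitor

section

variable {X Y Z W X' Y' Z' : TwistedCenter k G α}

theorem tensorHom_lin (φ : X ⟶ X') (ψ : Y ⟶ Y') :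
    (tensorHom φ ψ).lin = TensorProduct.map φ.lin ψ.lin := rfl

theorem associator_hom_lin : (associator X Y Z).hom.lin = assocLin X Y Z := rfl

theorem associator_inv_lin : (associator X Y Z).inv.lin = assocInvLin X Y Z := rfl

theorem leftUnitor_hom_lin (c : ULift.{v} k) (x : X.carrier) :
    (leftUnitor X).hom.lin (c ⊗ₜ x) = c.down • x := rfl

theorem rightUnitor_hom_lin (c : ULift.{v} k) (x : X.carrier) :
    (rightUnitor X).hom.lin (x ⊗ₜ c) = c.down • x := rfl

theorem braidIso_hom_lin : (braidIso X Y).hom.lin = braidLin X Y := rfl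

theorem pentagon_aux :
    tensorHom (associator W X Y).hom (𝟙 Z) ≫ (associator W (tensorObj X Y) Z).hom ≫
      tensorHom (𝟙 W) (associator X Y Z).hom =
    (associator (tensorObj W X) Y Z).hom ≫ (associator W X (tensorObj Y Z)).hom := by
  refine hom_ext ?_
  simp only [comp_lin, id_lin, tensorHom_lin, associator_hom_lin]
  refine TensorProduct.ext <| lin_ext₃ fun f g h w x y hw hx hy => lin_ext fun l z hz => ?_
  change (TensorProduct.map LinearMap.id (assocLin X Y Z))
      (assocLin W (tensorObj X Y) Z (assocLin W X Y ((w ⊗ₜ x) ⊗ₜ y) ⊗ₜ z)) =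
    assocLin W X (tensorObj Y Z) (assocLin (tensorObj W X) Y Z (((w ⊗ₜ x) ⊗ₜ y) ⊗ₜ z))
  rw [assocLin_tmul hw hx hy, ← TensorProduct.smul_tmul', map_smul, map_smul,
    assocLin_tmul hw (tensor_homog hx hy) hz, map_smul, TensorProduct.map_tmul,
    assocLin_tmul hx hy hz, assocLin_tmul (tensor_homog hw hx) hy hz, map_smul,
    assocLin_tmul hw hx (tensor_homog hy hz), TensorProduct.tmul_smul]
  simp only [smul_smul, LinearMap.id_apply]
  congr 1
  have key : ∀ A B C D E : kˣ, A * B * C = D * E → C⁻¹ * (B⁻¹ * A⁻¹) = D⁻¹ * E⁻¹ := by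
    intro A B C D E h
    rw [← mul_inv_rev, ← mul_inv_rev, h, mul_inv]
  exact_mod_cast congrArg Units.val (key _ _ _ _ _ (α.cocycle f g h l))

theorem hexagon_aux₁ :
    (associator X Y Z).hom ≫ (braidIso X (tensorObj Y Z)).hom ≫ (associator Y Z X).hom =
      tensorHom (braidIso X Y).hom (𝟙 Z) ≫ (associator Y X Z).hom ≫
        tensorHom (𝟙 Y) (braidIso X Z).hom := by
  refine hom_ext ?_
  simp only [comp_lin, id_lin, tensorHom_lin, associator_hom_lin, braidIso_hom_lin]
  refine lin_ext₃ fun f g h x y z hx hy hz => ?_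
  simp only [LinearMap.comp_apply, TensorProduct.map_tmul, LinearMap.id_apply]
  rw [assocLin_tmul hx hy hz, map_smul, map_smul, braidLin_tmul hx, braidLin_tmul hx,
    tensorAct_tmul f hy hz, ← TensorProduct.smul_tmul', map_smul,
    assocLin_tmul (act_homog f hy) (act_homog f hz) hx,
    assocLin_tmul (act_homog f hy) hx hz, map_smul, TensorProduct.map_tmul, braidLin_tmul hx]
  simp only [smul_smul, LinearMap.id_apply]
  congr 1
  rw [NormCocycle.tensorTwist]
  simp

theorem hexagon_aux₂ :
    (associator X Y Z).inv ≫ (braidIso (tensorObj X Y) Z).hom ≫ (associator Z X Y).inv =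
      tensorHom (𝟙 X) (braidIso Y Z).hom ≫ (associator X Z Y).inv ≫
        tensorHom (braidIso X Z).hom (𝟙 Y) := by
  refine hom_ext ?_
  simp only [comp_lin, id_lin, tensorHom_lin, associator_inv_lin, braidIso_hom_lin]
  refine lin_ext₃' fun f g h x y z hx hy hz => ?_
  simp only [LinearMap.comp_apply, TensorProduct.map_tmul, LinearMap.id_apply]
  have h1 : Z.pr (f * g * h * (f * g)⁻¹) (Z.act f (Z.act g z)) = Z.act f (Z.act g z) := by
    have := act_homog f (act_homog g hz)
    rwa [show f * (g * h * g⁻¹) * f⁻¹ = f * g * h * (f * g)⁻¹ by group] at this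
  rw [assocInvLin_tmul hx hy hz, map_smul, map_smul, braidLin_tmul (tensor_homog hx hy),
    act_mul_homog f g hz, ← TensorProduct.smul_tmul', map_smul, assocInvLin_tmul h1 hx hy,
    braidLin_tmul hy, assocInvLin_tmul hx (act_homog g hz) hy, map_smul, TensorProduct.map_tmul,
    braidLin_tmul hx]
  simp only [smul_smul, LinearMap.id_apply]
  congr 1
  rw [NormCocycle.actTwist]
  simp

end

noncomputable instance : MonoidalCategory (TwistedCenter k G α) :=
  MonoidalCategory.ofTensorHom
    (id_tensorHom_id := fun X Y => hom_ext (TensorProduct.map_id))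
    (id_tensorHom := fun _ _ _ _ => rfl)
    (tensorHom_id := fun _ _ => rfl)
    (tensorHom_comp_tensorHom := fun φ₁ φ₂ ψ₁ ψ₂ => hom_ext (TensorProduct.map_comp _ _ _ _).symm)
    (associator_naturality := fun {X₁ X₂ X₃ Y₁ Y₂ Y₃} φ₁ φ₂ φ₃ =>
      show tensorHom (tensorHom φ₁ φ₂) φ₃ ≫ (associator Y₁ Y₂ Y₃).hom =
        (associator X₁ X₂ X₃).hom ≫ tensorHom φ₁ (tensorHom φ₂ φ₃) from by
      refine hom_ext ?_
      simp only [comp_lin, tensorHom_lin, associator_hom_lin]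
      refine lin_ext₃ fun f g h x y z hx hy hz => ?_
      simp only [LinearMap.comp_apply, TensorProduct.map_tmul]
      rw [assocLin_tmul hx hy hz, map_smul, TensorProduct.map_tmul, TensorProduct.map_tmul,
        assocLin_tmul (lin_homog φ₁ hx) (lin_homog φ₂ hy) (lin_homog φ₃ hz)])
    (leftUnitor_naturality := fun {X Y} φ =>
      show tensorHom (𝟙 (unitObj α)) φ ≫ (leftUnitor Y).hom = (leftUnitor X).hom ≫ φ from by
      refine hom_ext (TensorProduct.ext' fun c x => ?_)
      change c.down • φ.lin x = φ.lin (c.down • x)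
      rw [map_smul])
    (rightUnitor_naturality := fun {X Y} φ =>
      show tensorHom φ (𝟙 (unitObj α)) ≫ (rightUnitor Y).hom = (rightUnitor X).hom ≫ φ from by
      refine hom_ext (TensorProduct.ext' fun x c => ?_)
      change c.down • φ.lin x = φ.lin (c.down • x)
      rw [map_smul])
    (pentagon := fun W X Y Z => pentagon_aux)
    (triangle := fun X Y =>
      show (associator X (unitObj α) Y).hom ≫ tensorHom (𝟙 X) (leftUnitor Y).hom =
        tensorHom (rightUnitor X).hom (𝟙 Y) from by
      refine hom_ext (lin_ext₃ fun f g h x c y hx hc hy => ?_)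
      change TensorProduct.map LinearMap.id (leftUnitor Y).hom.lin
        (assocLin X (unitObj α) Y ((x ⊗ₜ c) ⊗ₜ y)) = (c.down • x) ⊗ₜ y
      rw [assocLin_tmul hx hc hy, map_smul, TensorProduct.map_tmul, leftUnitor_hom_lin]
      rcases eq_or_zero_of_homog hc with rfl | rfl
      · simp [α.one_mid, TensorProduct.smul_tmul]
      · simp)

noncomputable instance : BraidedCategory (TwistedCenter k G α) where
  braiding := braidIso
  braiding_naturality_right X Y Z φ :=
    show tensorHom (𝟙 X) φ ≫ (braidIso X Z).hom = (braidIso X Y).hom ≫ tensorHom φ (𝟙 X) from by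
    refine hom_ext ?_
    simp only [comp_lin, id_lin, tensorHom_lin, braidIso_hom_lin]
    refine lin_ext₂ fun f g x y hx hy => ?_
    simp only [LinearMap.comp_apply, TensorProduct.map_tmul, LinearMap.id_apply]
    rw [braidLin_tmul hx, braidLin_tmul hx, TensorProduct.map_tmul, φ.lin_act]
    rfl
  braiding_naturality_left {X Y} φ Z :=
    show tensorHom φ (𝟙 Z) ≫ (braidIso Y Z).hom = (braidIso X Z).hom ≫ tensorHom (𝟙 Z) φ from by
    refine hom_ext ?_
    simp only [comp_lin, id_lin, tensorHom_lin, braidIso_hom_lin]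
    refine lin_ext₂ fun f g x z hx hz => ?_
    simp only [LinearMap.comp_apply, TensorProduct.map_tmul, LinearMap.id_apply]
    rw [braidLin_tmul hx, braidLin_tmul (lin_homog φ hx)]
    rfl
  hexagon_forward _ _ _ := hexagon_aux₁
  hexagon_reverse _ _ _ := hexagon_aux₂

section Preadditive

variable (X Y : TwistedCenter k G α)

instance : Zero (X ⟶ Y) := ⟨⟨0, by simp, by simp⟩⟩
instance : Add (X ⟶ Y) := ⟨fun φ ψ => ⟨φ.lin + ψ.lin, by simp [φ.lin_pr, ψ.lin_pr],
  by simp [φ.lin_act, ψ.lin_act]⟩⟩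
instance : Neg (X ⟶ Y) := ⟨fun φ => ⟨-φ.lin, by simp [φ.lin_pr], by simp [φ.lin_act]⟩⟩

instance : AddCommGroup (X ⟶ Y) where
  add_assoc _ _ _ := hom_ext (add_assoc _ _ _)
  zero_add _ := hom_ext (zero_add _)
  add_zero _ := hom_ext (add_zero _)
  add_comm _ _ := hom_ext (add_comm _ _)
  neg_add_cancel _ := hom_ext (neg_add_cancel _)
  nsmul := nsmulRec
  zsmul := zsmulRec

instance : Preadditive (TwistedCenter k G α) where
  add_comp _ _ _ _ _ _ := hom_ext (LinearMap.comp_add _ _ _)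
  comp_add _ _ _ _ _ _ := hom_ext (LinearMap.add_comp _ _ _)

@[simp] theorem add_lin (φ ψ : X ⟶ Y) : (φ + ψ).lin = φ.lin + ψ.lin := rfl

@[simp] theorem zero_lin : Hom.lin (0 : X ⟶ Y) = 0 := rfl

end Preadditive

end TwistedCenter

section Lagrangian

open CategoryTheory MonoidalCategory

universe w₁ w₂

variable {C : Type w₂} [Category.{w₁} C] [MonoidalCategory C]

/-- A (unital) right module over an algebra `A` in a monoidal category. -/
structure RightModule (A : C) [MonObj A] where
  carrier : C
  act : carrier ⊗ A ⟶ carrier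
  act_act : act ▷ A ≫ act = (α_ carrier A A).hom ≫ carrier ◁ MonObj.mul ≫ act
  act_one : carrier ◁ MonObj.one ≫ act = (ρ_ carrier).hom

namespace RightModule

variable {A : C} [MonObj A]

/-- Homomorphisms of right `A`-modules. -/
@[ext]
structure Hom (M N : RightModule A) where
  hom : M.carrier ⟶ N.carrier
  comm : M.act ≫ hom = hom ▷ A ≫ N.act

instance : Category (RightModule A) where
  Hom M N := Hom M N
  id M := ⟨𝟙 M.carrier, by simp⟩
  comp φ ψ := ⟨φ.hom ≫ ψ.hom, by
    rw [← Category.assoc, φ.comm, Category.assoc, ψ.comm, comp_whiskerRight, Category.assoc]⟩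
  id_comp φ := Hom.ext (Category.id_comp φ.hom)
  comp_id φ := Hom.ext (Category.comp_id φ.hom)
  assoc φ ψ θ := Hom.ext (Category.assoc φ.hom ψ.hom θ.hom)

/-- The regular right module `A`. -/
@[simps]
def regular (A : C) [MonObj A] : RightModule A where
  carrier := A
  act := MonObj.mul
  act_act := MonObj.mul_assoc A
  act_one := MonObj.mul_one A

/-- `M` is local if the action is unchanged by precomposition with the double braiding
`M ⊗ A ⟶ A ⊗ M ⟶ M ⊗ A`. -/
def IsLocal [BraidedCategory C] (M : RightModule A) : Prop :=
  (β_ M.carrier A).hom ≫ (β_ A M.carrier).hom ≫ M.act = M.act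

/-- `M` is a (finite, possibly empty) direct sum of copies of the regular module `A`. -/
def IsSumOfRegular [Preadditive C] (M : RightModule A) : Prop :=
  ∃ (n : ℕ) (ι : Fin n → (regular A ⟶ M)) (π : Fin n → (M ⟶ regular A)),
    (∀ i, (ι i ≫ π i).hom = 𝟙 A) ∧ (∀ i j, i ≠ j → (ι i ≫ π j).hom = 0) ∧
      ∑ i, (π i ≫ ι i).hom = 𝟙 M.carrier

end RightModule

/-- A commutative algebra in an additive braided category is Lagrangian if every local right
module over it is a direct sum of copies of the regular module. -/
def IsLagrangian [BraidedCategory C] [Preadditive C] (A : C) [MonObj A] [IsCommMonObj A] : Prop :=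
  ∀ M : RightModule A, M.IsLocal → M.IsSumOfRegular

end Lagrangian

/-- The data `(γ, ε)` of an etale algebra `k[F, γ, ε]` in `𝒵(H, α)`, for `F ⊴ H`.  Here
`MulAut.conjNormal h f = h f h⁻¹` as an element of `F`. -/
structure EtaleDatum {k : Type*} [Field k] {H : Type*} [Group H] (α : NormCocycle k H)
    (F : Subgroup H) [F.Normal] where
  γ : F → F → kˣ
  ε : H → F → kˣ
  d_γ : ∀ f g h : F,
    γ g h * (γ (f * g) h)⁻¹ * γ f (g * h) * (γ f g)⁻¹ = α.toFun f g h
  ε_mul : ∀ (g h : H) (f : F),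
    ε (g * h) f = α.actTwist g h f * ε g (MulAut.conjNormal h f) * ε h f
  ε_γ : ∀ (h : H) (f g : F),
    γ f g * ε h (f * g) = α.tensorTwist h f g * ε h f * ε h g *
      γ (MulAut.conjNormal h f) (MulAut.conjNormal h g)
  γ_comm : ∀ f g : F, γ f g = ε f g * γ (f * g * f⁻¹) f

namespace EtaleDatum

variable {k : Type u} [Field k] {H : Type v} [Group H] {α : NormCocycle k H}
  {F : Subgroup H} [F.Normal] (D : EtaleDatum α F)

open CategoryTheory MonoidalCategory TwistedCenter

theorem γ_one_left (f : F) : D.γ 1 f = D.γ 1 1 := by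
  have := D.d_γ 1 1 f
  simpa [α.one_left, mul_inv_eq_one] using this

theorem γ_one_right (f : F) : D.γ f 1 = D.γ 1 1 := by
  have := D.d_γ f 1 1
  simp [α.one_right, mul_inv_eq_one] at this
  exact this.symm

theorem ε_one (f : F) : D.ε 1 f = 1 := by
  have := D.ε_mul 1 1 f
  simpa using this

theorem ε_unit (h : H) : D.ε h 1 = 1 := by
  have := D.ε_γ h 1 1
  simp only [mul_one, map_one, OneMemClass.coe_one, NormCocycle.tensorTwist_one_left, one_mul] at this
  rw [mul_comm, mul_left_inj] at this
  simpa using this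

/-- The projection of `k[F]` onto the degree `g` component: `e_f ↦ e_f` if `f = g`, else `0`. -/
noncomputable def pr (F : Subgroup H) (g : H) : Module.End k (F →₀ k) :=
  open Classical in
  Finsupp.linearCombination k fun f : F => if (f : H) = g then Finsupp.single f 1 else 0

/-- The action `h.e_f = ε_h(f) e_{hfh⁻¹}`. -/
noncomputable def act (h : H) : Module.End k (F →₀ k) :=
  Finsupp.linearCombination k fun f : F =>
    (D.ε h f : k) • Finsupp.single (MulAut.conjNormal h f) (1 : k)

/-- The multiplication `e_f e_g = γ(f, g) e_{fg}`. -/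
noncomputable def mulLin : (F →₀ k) ⊗[k] (F →₀ k) →ₗ[k] (F →₀ k) :=
  TensorProduct.lift <| Finsupp.linearCombination k fun f : F =>
    Finsupp.linearCombination k fun g : F => (D.γ f g : k) • Finsupp.single (f * g) (1 : k)

/-- The unit `1 ↦ γ(1, 1)⁻¹ e_1`. -/
noncomputable def oneLin : ULift.{v} k →ₗ[k] (F →₀ k) :=
  LinearMap.toSpanSingleton k (F →₀ k) ((((D.γ 1 1)⁻¹ : kˣ) : k) • Finsupp.single 1 (1 : k)) ∘ₗ
    ULift.moduleEquiv.toLinearMap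

theorem pr_self (f : F) :
    pr F (f : H) (Finsupp.single f (1 : k)) = Finsupp.single f (1 : k) := by
  simp [pr]

theorem pr_ne {f : F} {g : H} (h : (f : H) ≠ g) :
    pr F g (Finsupp.single f (1 : k)) = 0 := by
  simp [pr, h]

theorem act_single (h : H) (f : F) : D.act h (Finsupp.single f (1 : k)) =
    (D.ε h f : k) • Finsupp.single (MulAut.conjNormal h f) (1 : k) := by
  simp [act]

theorem mulLin_single (f g : F) :
    D.mulLin (Finsupp.single f (1 : k) ⊗ₜ Finsupp.single g (1 : k)) =
      (D.γ f g : k) • Finsupp.single (f * g) (1 : k) := by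
  simp [mulLin]

theorem oneLin_up (c : ULift.{v} k) :
    D.oneLin c = c.down • (((D.γ 1 1)⁻¹ : kˣ) : k) • Finsupp.single 1 (1 : k) := rfl

theorem ext_single {M : Type*} [AddCommGroup M] [Module k M] {φ ψ : (F →₀ k) →ₗ[k] M}
    (h : ∀ f : F, φ (Finsupp.single f 1) = ψ (Finsupp.single f 1)) : φ = ψ :=
  Finsupp.lhom_ext' fun f => LinearMap.ext_ring (h f)

variable [Fintype H]

/-- The object `k[F, γ, ε] = ⨁_{f ∈ F} k e_f` of `𝒵(H, α)`. -/
noncomputable abbrev obj : TwistedCenter k H α where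
  carrier := F →₀ k
  pr := pr F
  pr_complete := by
    classical
    refine ⟨⟨fun g => ?_, fun g h hg => ?_⟩, ?_⟩
    · refine ext_single fun f => ?_
      rw [Module.End.mul_apply]
      by_cases hf : (f : H) = g
      · subst hf; simp only [pr_self]
      · simp only [pr_ne hf, map_zero]
    · refine ext_single fun f => ?_
      change pr F g (pr F h _) = 0
      by_cases hf : (f : H) = h
      · subst hf; rw [pr_self, pr_ne (Ne.symm hg)]
      · rw [pr_ne hf, map_zero]
    · refine ext_single fun f => ?_
      rw [LinearMap.sum_apply, Finset.sum_eq_single (f : H)]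
      · rw [pr_self]; rfl
      · intro b _ hb
        exact pr_ne (Ne.symm hb)
      · simp
  act := D.act
  act_pr := by
    intro h g v
    suffices e : D.act h ∘ₗ pr F g = pr F (h * g * h⁻¹) ∘ₗ D.act h from
      congrArg (fun θ : Module.End k (F →₀ k) => θ v) e
    refine ext_single fun f => ?_
    simp only [LinearMap.comp_apply, act_single, map_smul]
    by_cases hf : (f : H) = g
    · subst hf
      rw [pr_self, act_single, ← MulAut.conjNormal_apply, pr_self]
    · rw [pr_ne hf, pr_ne, map_zero, smul_zero]
      rw [MulAut.conjNormal_apply]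
      intro e
      exact hf (mul_left_cancel (mul_right_cancel e))
  act_one := by
    refine ext_single fun f => ?_
    rw [act_single, ε_one]
    simp
  act_mul := by
    intro g h l v
    suffices e : D.act (g * h) ∘ₗ pr F l =
        (α.actTwist g h l : k) • (D.act g ∘ₗ D.act h ∘ₗ pr F l) from
      congrArg (fun θ : Module.End k (F →₀ k) => θ v) e
    refine ext_single fun f => ?_
    simp only [LinearMap.comp_apply, LinearMap.smul_apply]
    by_cases hf : (f : H) = l
    · subst hf
      rw [pr_self, act_single, act_single, map_smul, act_single, D.ε_mul, map_mul]
      simp only [smul_smul, MulAut.mul_apply]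
      congr 1
      push_cast
      ring
    · rw [pr_ne hf]; simp

theorem ext_single₂ {M : Type*} [AddCommGroup M] [Module k M]
    {φ ψ : (F →₀ k) ⊗[k] (F →₀ k) →ₗ[k] M}
    (h : ∀ f g : F, φ (Finsupp.single f 1 ⊗ₜ Finsupp.single g 1) =
      ψ (Finsupp.single f 1 ⊗ₜ Finsupp.single g 1)) : φ = ψ :=
  TensorProduct.ext <| ext_single fun f => ext_single fun g => h f g

/-- The algebra `k[F, γ, ε]` in `𝒵(H, α)`. -/
noncomputable instance : MonObj D.obj where
  one :=
    { lin := D.oneLin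
      lin_pr := pr_of_homog (X := unitObj α) (Y := D.obj) _ fun g c hc => by
        rcases eq_or_zero_of_homog hc with rfl | rfl
        · rw [oneLin_up, map_smul, map_smul]
          congr 2
          exact pr_self 1
        · simp
      lin_act := by
        intro h c
        change D.oneLin c = D.act h (D.oneLin c)
        rw [oneLin_up, map_smul, map_smul, act_single, ε_unit]
        simp }
  mul :=
    { lin := D.mulLin
      lin_pr := by
        intro h t
        suffices e : D.mulLin ∘ₗ tensorPr D.obj D.obj h = pr F h ∘ₗ D.mulLin from
          congrArg (fun θ => θ t) e
        refine ext_single₂ fun f g => ?_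
        have hf : D.obj.pr f (Finsupp.single f (1 : k)) = Finsupp.single f (1 : k) := pr_self f
        have hg : D.obj.pr g (Finsupp.single g (1 : k)) = Finsupp.single g (1 : k) := pr_self g
        simp only [LinearMap.comp_apply, mulLin_single, map_smul]
        by_cases hh : h = (f : H) * g
        · subst hh
          rw [tensorPr_tmul hf hg, mulLin_single, ← Subgroup.coe_mul, pr_self]
        · rw [tensorPr_tmul_ne hf hg hh, pr_ne, map_zero, smul_zero]
          exact fun e => hh e.symm
      lin_act := by
        intro h t
        suffices e : D.mulLin ∘ₗ tensorAct D.obj D.obj h = D.act h ∘ₗ D.mulLin from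
          congrArg (fun θ => θ t) e
        refine ext_single₂ fun f g => ?_
        have hf : D.obj.pr f (Finsupp.single f (1 : k)) = Finsupp.single f (1 : k) := pr_self f
        have hg : D.obj.pr g (Finsupp.single g (1 : k)) = Finsupp.single g (1 : k) := pr_self g
        simp only [LinearMap.comp_apply]
        rw [tensorAct_tmul h hf hg, mulLin_single, map_smul, map_smul, act_single, act_single,
          act_single, TensorProduct.smul_tmul_smul, map_smul, mulLin_single, map_mul]
        simp only [smul_smul]
        congr 1
        have := congrArg Units.val (D.ε_γ h f g)
        push_cast at this
        rw [this]
        ring }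
  one_mul := by
    refine hom_ext (TensorProduct.ext' fun c x => ?_)
    change D.mulLin (D.oneLin c ⊗ₜ x) = c.down • x
    suffices e : D.mulLin ∘ₗ TensorProduct.mk k _ _ (D.oneLin c) = c.down • LinearMap.id from
      congrArg (fun θ : Module.End k (F →₀ k) => θ x) e
    refine ext_single fun f => ?_
    change D.mulLin (D.oneLin c ⊗ₜ _) = c.down • _
    rw [oneLin_up, ← TensorProduct.smul_tmul', ← TensorProduct.smul_tmul', map_smul, map_smul,
      mulLin_single, D.γ_one_left f, one_mul, smul_smul (((D.γ 1 1)⁻¹ : kˣ) : k), Units.inv_mul,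
      one_smul]
    rfl
  mul_one := by
    refine hom_ext (TensorProduct.ext' fun x c => ?_)
    change D.mulLin (x ⊗ₜ D.oneLin c) = c.down • x
    suffices e : D.mulLin ∘ₗ (TensorProduct.mk k _ _).flip (D.oneLin c) =
        c.down • LinearMap.id from
      congrArg (fun θ : Module.End k (F →₀ k) => θ x) e
    refine ext_single fun f => ?_
    change D.mulLin (_ ⊗ₜ D.oneLin c) = c.down • _
    rw [oneLin_up, TensorProduct.tmul_smul, TensorProduct.tmul_smul, map_smul, map_smul,
      mulLin_single, D.γ_one_right f, mul_one, smul_smul (((D.γ 1 1)⁻¹ : kˣ) : k), Units.inv_mul,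
      one_smul]
    rfl
  mul_assoc := by
    refine hom_ext (TensorProduct.ext <| ext_single₂ fun f g => ext_single fun h => ?_)
    change D.mulLin (D.mulLin (Finsupp.single f 1 ⊗ₜ Finsupp.single g 1) ⊗ₜ Finsupp.single h 1) =
      D.mulLin (TensorProduct.map LinearMap.id D.mulLin (assocLin D.obj D.obj D.obj
        ((Finsupp.single f 1 ⊗ₜ Finsupp.single g 1) ⊗ₜ Finsupp.single h 1)))
    have hf : D.obj.pr f (Finsupp.single f (1 : k)) = Finsupp.single f (1 : k) := pr_self f
    have hg : D.obj.pr g (Finsupp.single g (1 : k)) = Finsupp.single g (1 : k) := pr_self g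
    have hh : D.obj.pr h (Finsupp.single h (1 : k)) = Finsupp.single h (1 : k) := pr_self h
    rw [assocLin_tmul hf hg hh, map_smul, TensorProduct.map_tmul, mulLin_single, mulLin_single,
      ← TensorProduct.smul_tmul', TensorProduct.tmul_smul, map_smul, map_smul, map_smul,
      LinearMap.id_apply, mulLin_single, mulLin_single, mul_assoc]
    simp only [smul_smul]
    congr 1
    have key : ∀ A B C E X : kˣ, A * B⁻¹ * C * E⁻¹ = X → E * B = X⁻¹ * (A * C) := by
      rintro A B C E X rfl
      rw [eq_inv_mul_iff_mul_eq]
      calc A * B⁻¹ * C * E⁻¹ * (E * B) = A * C * (B⁻¹ * B) * (E⁻¹ * E) := by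
            simp only [mul_comm, mul_left_comm, mul_assoc]
        _ = A * C := by simp
    have := congrArg Units.val (key _ _ _ _ _ (D.d_γ f g h))
    push_cast at this
    rw [this]
    push_cast
    ring

/-- The algebra `k[F, γ, ε]` is commutative. -/
instance : IsCommMonObj D.obj where
  mul_comm := by
    refine hom_ext (ext_single₂ fun f g => ?_)
    have hf : D.obj.pr f (Finsupp.single f (1 : k)) = Finsupp.single f (1 : k) := pr_self f
    change D.mulLin (braidLin D.obj D.obj _) = D.mulLin _
    rw [braidLin_tmul hf]
    change D.mulLin (D.act f _ ⊗ₜ _) = _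
    rw [act_single, ← TensorProduct.smul_tmul', map_smul, mulLin_single, mulLin_single,
      D.γ_comm f g]
    have : MulAut.conjNormal (f : H) g = f * g * f⁻¹ := by
      ext; simp
    rw [this, smul_smul, inv_mul_cancel_right]
    push_cast
    rfl

end EtaleDatum

/-!
Write `A = k[F, γ, ε]`. An object `X` concentrated in degree `1` is an untwisted representation of
`H`, and its double braiding with `A` sends `x ⊗ e_f` to `f.x ⊗ e_f`; hence the free module `X ⊗ A`
is local as soon as `F` acts trivially on `X`, as it does on `X = k[H/F]`. If `X ⊗ A` is a sum of
copies of `A`, then `H` acts trivially on its degree `1` component, since it fixes `A_1 = k e_1`;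
this component is `X ⊗ e_1`, so `H` acts trivially on `H/F` and `F = H`.

Conversely, right multiplication by `e_f` is a bijection `M_g → M_{gf}` for every `A`-module `M`. If
`M` is local, then `(f.m) e_f = m e_f` for `m ∈ M_1`, so `F` acts trivially on `M_1`. If moreover
`F = H`, then `M_1 ⊗ A ≅ M`, and `M_1` is a sum of copies of the unit object.
-/

section

open CategoryTheory MonoidalCategory

/-- `X` is a direct sum of finitely many (possibly zero) copies of the unit object, presented as in
`RightModule.IsSumOfRegular` by inclusions and projections. -/
def IsSumOfUnit {C : Type*} [Category* C] [MonoidalCategory C] [Preadditive C] (X : C) : Prop :=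
  ∃ (n : ℕ) (ι : Fin n → (𝟙_ C ⟶ X)) (π : Fin n → (X ⟶ 𝟙_ C)),
    (∀ i, ι i ≫ π i = 𝟙 (𝟙_ C)) ∧ (∀ i j, i ≠ j → ι i ≫ π j = 0) ∧ ∑ i, π i ≫ ι i = 𝟙 X

end

namespace RightModule

open CategoryTheory MonoidalCategory

variable {C : Type*} [Category* C] [MonoidalCategory C] {A : C} [MonObj A]

@[simp] theorem id_hom (M : RightModule A) : Hom.hom (𝟙 M) = 𝟙 M.carrier := rfl

@[simp] theorem comp_hom {M N P : RightModule A} (φ : M ⟶ N) (ψ : N ⟶ P) :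
    (φ ≫ ψ).hom = φ.hom ≫ ψ.hom := rfl

/-- A homomorphism of modules which is an isomorphism in the ambient category is an isomorphism of
modules. -/
noncomputable def isoOfIsIsoHom {M N : RightModule A} (φ : M ⟶ N) [IsIso φ.hom] : M ≅ N where
  hom := φ
  inv :=
    { hom := inv φ.hom
      comm := by
        rw [← cancel_epi (φ.hom ▷ A), ← Category.assoc, ← φ.comm, ← comp_whiskerRight_assoc]
        simp }
  hom_inv_id := Hom.ext (by simp)
  inv_hom_id := Hom.ext (by simp)

/-- The free right module `X ⊗ A` on an object `X`. -/
abbrev free (A : C) [MonObj A] (X : C) : RightModule A where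
  carrier := X ⊗ A
  act := (α_ X A A).hom ≫ X ◁ MonObj.mul
  act_act := by
    simp only [comp_whiskerRight, whisker_assoc, Category.assoc, Iso.inv_hom_id_assoc,
      tensor_whiskerLeft]
    rw [← MonoidalCategory.whiskerLeft_comp, MonObj.mul_assoc]
    simp
  act_one := by
    simp only [tensor_whiskerLeft, Category.assoc, Iso.inv_hom_id_assoc,
      ← MonoidalCategory.whiskerLeft_comp, MonObj.mul_one, rightUnitor_tensor_hom]

/-- The functoriality of the free module. -/
@[simps]
def freeMap (A : C) [MonObj A] {X Y : C} (φ : X ⟶ Y) : free A X ⟶ free A Y where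
  hom := φ ▷ A
  comm := by
    change ((α_ X A A).hom ≫ X ◁ MonObj.mul) ≫ φ ▷ A = φ ▷ A ▷ A ≫ (α_ Y A A).hom ≫ Y ◁ MonObj.mul
    rw [Category.assoc, whisker_exchange, associator_naturality_left_assoc]

/-- The free module on the unit object is the regular module. -/
@[simps]
def freeUnitIso (A : C) [MonObj A] : free A (𝟙_ C) ≅ regular A where
  hom :=
    { hom := (λ_ A).hom
      comm := by
        change ((α_ (𝟙_ C) A A).hom ≫ 𝟙_ C ◁ MonObj.mul) ≫ (λ_ A).hom = (λ_ A).hom ▷ A ≫ MonObj.mul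
        simp }
  inv :=
    { hom := (λ_ A).inv
      comm := by
        change MonObj.mul ≫ (λ_ A).inv =
          (λ_ A).inv ▷ A ≫ (α_ (𝟙_ C) A A).hom ≫ 𝟙_ C ◁ MonObj.mul
        simp }
  hom_inv_id := Hom.ext (λ_ A).hom_inv_id
  inv_hom_id := Hom.ext (λ_ A).inv_hom_id

/-- The homomorphism of modules `X ⊗ A ⟶ M` induced by `φ : X ⟶ M` through the adjunction between
free modules and the forgetful functor. -/
@[simps]
def freeLift {M : RightModule A} {X : C} (φ : X ⟶ M.carrier) : free A X ⟶ M where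
  hom := φ ▷ A ≫ M.act
  comm := by
    change ((α_ X A A).hom ≫ X ◁ MonObj.mul) ≫ φ ▷ A ≫ M.act = (φ ▷ A ≫ M.act) ▷ A ≫ M.act
    rw [comp_whiskerRight, Category.assoc, Category.assoc, M.act_act, whisker_exchange_assoc,
      associator_naturality_left_assoc]

theorem isLocal_free [BraidedCategory C] [IsCommMonObj A] {X : C}
    (hX : (β_ X A).hom ≫ (β_ A X).hom = 𝟙 (X ⊗ A)) : (free A X).IsLocal := by
  have hX' : (β_ X A).hom ▷ A ≫ (β_ A X).hom ▷ A = 𝟙 _ := by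
    rw [← comp_whiskerRight, hX, id_whiskerRight]
  change (β_ (X ⊗ A) A).hom ≫ (β_ A (X ⊗ A)).hom ≫ (α_ X A A).hom ≫ X ◁ MonObj.mul =
    (α_ X A A).hom ≫ X ◁ MonObj.mul
  -- By the hexagons, the double braiding of `X ⊗ A` with `A` is that of `X` with `A` between two
  -- self-braidings of `A`, and the latter are absorbed by the commutative multiplication.
  simp [BraidedCategory.braiding_tensor_left_hom, BraidedCategory.braiding_tensor_right_hom,
    reassoc_of% hX', ← MonoidalCategory.whiskerLeft_comp]

section Preadditive

variable [Preadditive C] {M N : RightModule A}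

theorem IsSumOfRegular.of_iso (hM : M.IsSumOfRegular) (e : M ≅ N) : N.IsSumOfRegular := by
  obtain ⟨n, ι, π, hself, hne, hsum⟩ := hM
  have hcancel : ∀ i j, (ι i ≫ e.hom) ≫ e.inv ≫ π j = ι i ≫ π j := fun i j => by simp
  refine ⟨n, fun i => ι i ≫ e.hom, fun i => e.inv ≫ π i, fun i => ?_, fun i j hij => ?_, ?_⟩
  · rw [hcancel, hself]
  · rw [hcancel, hne i j hij]
  · calc ∑ i, ((e.inv ≫ π i) ≫ ι i ≫ e.hom).hom
        = e.inv.hom ≫ (∑ i, (π i ≫ ι i).hom) ≫ e.hom.hom := by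
          simp [Preadditive.comp_sum, Preadditive.sum_comp]
      _ = (e.inv ≫ e.hom).hom := by rw [hsum, Category.id_comp, comp_hom]
      _ = 𝟙 N.carrier := by rw [e.inv_hom_id, id_hom]

theorem isSumOfRegular_free [MonoidalPreadditive C] {X : C} (hX : IsSumOfUnit X) :
    (free A X).IsSumOfRegular := by
  obtain ⟨n, ι, π, hself, hne, hsum⟩ := hX
  have hcomp : ∀ i j, (((freeUnitIso A).inv ≫ freeMap A (ι i)) ≫
      freeMap A (π j) ≫ (freeUnitIso A).hom).hom = (λ_ A).inv ≫ (ι i ≫ π j) ▷ A ≫ (λ_ A).hom :=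
    fun i j => by
      change ((λ_ A).inv ≫ ι i ▷ A) ≫ π j ▷ A ≫ (λ_ A).hom = _
      simp
  refine ⟨n, fun i => (freeUnitIso A).inv ≫ freeMap A (ι i),
    fun i => freeMap A (π i) ≫ (freeUnitIso A).hom, fun i => ?_, fun i j hij => ?_, ?_⟩
  · rw [hcomp, hself, id_whiskerRight, Category.id_comp, Iso.inv_hom_id]
  · rw [hcomp, hne i j hij, MonoidalPreadditive.zero_whiskerRight, Limits.zero_comp,
      Limits.comp_zero]
    rfl
  · calc ∑ i, ((freeMap A (π i) ≫ (freeUnitIso A).hom) ≫ (freeUnitIso A).inv ≫ freeMap A (ι i)).hom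
        = (∑ i, (π i ≫ ι i) ▷ A : X ⊗ A ⟶ X ⊗ A) :=
          Finset.sum_congr rfl fun i _ => by simp
      _ = (∑ i, π i ≫ ι i) ▷ A := (sum_whiskerRight _ _ _).symm
      _ = 𝟙 (X ⊗ A) := by rw [hsum, id_whiskerRight]

end Preadditive

end RightModule

namespace TwistedCenter

open CategoryTheory MonoidalCategory

variable {k : Type u} [Field k] {G : Type v} [Group G] [Fintype G] {α : NormCocycle k G}
  {X Y : TwistedCenter k G α}

noncomputable instance : MonoidalPreadditive (TwistedCenter k G α) where
  whiskerLeft_zero := hom_ext (TensorProduct.map_zero_right _)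
  zero_whiskerRight := hom_ext (TensorProduct.map_zero_left _)
  whiskerLeft_add _ _ := hom_ext (TensorProduct.map_add_right _ _ _)
  add_whiskerRight _ _ := hom_ext (TensorProduct.map_add_left _ _ _)

theorem sum_lin {σ : Type*} (s : Finset σ) (φ : σ → (X ⟶ Y)) :
    Hom.lin (∑ i ∈ s, φ i : X ⟶ Y) = ∑ i ∈ s, (φ i).lin :=
  map_sum ({ toFun := Hom.lin, map_zero' := rfl, map_add' := fun _ _ => rfl } :
    (X ⟶ Y) →+ (X.carrier →ₗ[k] Y.carrier)) φ s

theorem isIso_of_bijective_lin (φ : X ⟶ Y) (hφ : Function.Bijective φ.lin) : IsIso φ :=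
  let e := LinearEquiv.ofBijective φ.lin hφ
  (isoOfLin φ e.symm (LinearMap.ext e.symm_apply_apply)
    (LinearMap.ext e.apply_symm_apply)).isIso_hom

theorem braiding_comp_braiding_tmul {g : G} {x : X.carrier} {y : Y.carrier} (hx : X.pr 1 x = x)
    (hy : Y.pr g y = y) :
    ((β_ X Y).hom ≫ (β_ Y X).hom).lin (x ⊗ₜ[k] y) = X.act g x ⊗ₜ y := by
  change braidLin Y X (braidLin X Y (x ⊗ₜ y)) = _
  rw [braidLin_tmul hx, Y.act_one, Module.End.one_apply, braidLin_tmul hy]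

theorem lin_pr_of_pr_one (hX : X.pr 1 = 1) (φ : X.carrier →ₗ[k] Y.carrier)
    (hφ : ∀ x, Y.pr 1 (φ x) = φ x) (g : G) (x : X.carrier) : φ (X.pr g x) = Y.pr g (φ x) := by
  by_cases hg : g = 1
  · rw [hg, hX, Module.End.one_apply, hφ]
  · rw [pr_ne (LinearMap.congr_fun hX x) hg, pr_ne (hφ x) hg, map_zero]

/-- An object is trivial if it is concentrated in degree `1` and acted on trivially. -/
structure IsTrivial (X : TwistedCenter k G α) : Prop where
  pr_one : X.pr 1 = 1
  act_eq_one : ∀ g, X.act g = 1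

theorem isTrivial_unit : IsTrivial (𝟙_ (TwistedCenter k G α)) where
  pr_one := if_pos rfl
  act_eq_one _ := rfl

/-- Every linear map between trivial objects is a morphism. -/
def IsTrivial.homOfLin (hX : X.IsTrivial) (hY : Y.IsTrivial) (φ : X.carrier →ₗ[k] Y.carrier) :
    X ⟶ Y where
  lin := φ
  lin_pr := lin_pr_of_pr_one hX.pr_one φ fun x => LinearMap.congr_fun hY.pr_one (φ x)
  lin_act g x := by
    rw [hX.act_eq_one, hY.act_eq_one, Module.End.one_apply, Module.End.one_apply]

theorem IsTrivial.isSumOfUnit (hX : X.IsTrivial) : IsSumOfUnit X := by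
  let b := Module.finBasis k X.carrier
  let e : (𝟙_ (TwistedCenter k G α)).carrier ≃ₗ[k] k := ULift.moduleEquiv
  let ι i := isTrivial_unit.homOfLin hX (LinearMap.toSpanSingleton k _ (b i) ∘ₗ e.toLinearMap)
  let π i := hX.homOfLin isTrivial_unit (e.symm.toLinearMap ∘ₗ b.coord i)
  have hlin : ∀ i j c, (ι i ≫ π j).lin c = e.symm (e c * b.coord j (b i)) := fun i j c =>
    congrArg e.symm ((b.coord j).map_smul _ _)
  refine ⟨_, ι, π, fun i => hom_ext (LinearMap.ext fun c => ?_),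
    fun i j hij => hom_ext (LinearMap.ext fun c => ?_), hom_ext (LinearMap.ext fun x => ?_)⟩
  · rw [hlin, b.coord_apply, b.repr_self, Finsupp.single_eq_same, mul_one, e.symm_apply_apply]
    rfl
  · rw [hlin, b.coord_apply, b.repr_self, Finsupp.single_eq_of_ne hij.symm, mul_zero, map_zero]
    rfl
  · rw [sum_lin, LinearMap.sum_apply]
    exact b.sum_repr x

/-- A representation of `G`, as an object of `𝒵(G, α)` concentrated in degree `1`. -/
noncomputable def ofRepresentation (α : NormCocycle k G) {V : Type (max u v)} [AddCommGroup V]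
    [Module k V] [Module.Finite k V] (ρ : Representation k G V) : TwistedCenter k G α where
  carrier := V
  pr := open Classical in fun g => if g = 1 then 1 else 0
  pr_complete := by
    classical
    refine ⟨⟨fun g => ?_, fun g g' hg => ?_⟩, by simp⟩
    · change _ * _ = _
      split_ifs <;> simp
    · change _ * _ = _
      split_ifs with h h'
      · exact absurd (h.trans h'.symm) hg
      all_goals simp
  act := ρ
  act_pr f g v := by by_cases hg : g = 1 <;> simp [hg]
  act_one := map_one ρ
  act_mul f g h v := by by_cases hh : h = 1 <;> simp [hh]

theorem ofRepresentation_pr_one (α : NormCocycle k G) {V : Type (max u v)} [AddCommGroup V]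
    [Module k V] [Module.Finite k V] (ρ : Representation k G V) :
    (ofRepresentation α ρ).pr 1 = 1 :=
  if_pos rfl

theorem pr_one_act {x : X.carrier} (hx : X.pr 1 x = x) (g : G) :
    X.pr 1 (X.act g x) = X.act g x := by
  simpa using act_homog g hx

variable (X)

theorem mem_range_pr_iff {g : G} {x : X.carrier} : x ∈ LinearMap.range (X.pr g) ↔ X.pr g x = x :=
  ⟨by rintro ⟨y, rfl⟩; exact X.pr_pr g y, fun hx => ⟨x, hx⟩⟩

/-- The action of `G` on the degree one component, where it is untwisted. -/
noncomputable def degreeOneRepresentation :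
    Representation k G (LinearMap.range (X.pr 1)) where
  toFun g := (X.act g).restrict fun x hx => by
    rw [mem_range_pr_iff] at hx ⊢; exact pr_one_act hx g
  map_one' := LinearMap.ext fun x => Subtype.ext (LinearMap.congr_fun X.act_one x)
  map_mul' f g := LinearMap.ext fun x => Subtype.ext <| by
    have := act_mul_homog f g (X.mem_range_pr_iff.1 x.2)
    simpa using this

/-- The degree one component of an object, as an object. -/
noncomputable def degreeOne : TwistedCenter k G α :=
  ofRepresentation α X.degreeOneRepresentation

/-- The inclusion of the degree one component. -/
noncomputable def degreeOneInclusion : X.degreeOne ⟶ X where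
  lin := (LinearMap.range (X.pr 1)).subtype
  lin_pr := lin_pr_of_pr_one (ofRepresentation_pr_one α _) _ fun x => X.mem_range_pr_iff.1 x.2
  lin_act _ _ := rfl

theorem degreeOne_pr_one : X.degreeOne.pr 1 = 1 :=
  ofRepresentation_pr_one α _

theorem degreeOneInclusion_injective : Function.Injective X.degreeOneInclusion.lin :=
  Subtype.val_injective

theorem range_degreeOneInclusion :
    LinearMap.range X.degreeOneInclusion.lin = LinearMap.range (X.pr 1) :=
  Submodule.range_subtype _

end TwistedCenter

theorem ofMulAction_eq_one_iff {R G X : Type*} [Semiring R] [Nontrivial R] [Monoid G]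
    [MulAction G X] {g : G} : Representation.ofMulAction R G X g = 1 ↔ ∀ x : X, g • x = x := by
  refine ⟨fun hg x => ?_, fun hg => ?_⟩
  · have hx := LinearMap.congr_fun hg (MonoidAlgebra.single x 1)
    rw [Representation.ofMulAction_single] at hx
    exact MonoidAlgebra.single_left_injective one_ne_zero hx
  · refine MonoidAlgebra.lhom_ext' fun x => LinearMap.ext_ring ?_
    change Representation.ofMulAction R G X g (.single x 1) = .single x 1
    rw [Representation.ofMulAction_single, hg]

theorem forall_smul_quotient_eq_iff {G : Type*} [Group G] {N : Subgroup G} [N.Normal] {g : G} :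
    (∀ x : G ⧸ N, g • x = x) ↔ g ∈ N := by
  calc (∀ x : G ⧸ N, g • x = x) ↔ g ∈ (MulAction.toPermHom G (G ⧸ N)).ker := by
        simp [Equiv.ext_iff]
    _ ↔ g ∈ N := by rw [← Subgroup.normalCore_eq_ker, N.normalCore_eq_self]

namespace EtaleDatum

open CategoryTheory MonoidalCategory TwistedCenter

variable {k : Type u} [Field k] {H : Type v} [Group H] {α : NormCocycle k H} {F : Subgroup H}
  [F.Normal] {D : EtaleDatum α F}

theorem act_single_one (h : H) : D.act h (Finsupp.single 1 1) = Finsupp.single 1 (1 : k) := by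
  rw [act_single, ε_unit, map_one, Units.val_one, one_smul]

variable [Fintype H]

theorem obj_pr_single (f : F) : D.obj.pr f (Finsupp.single f (1 : k)) = Finsupp.single f (1 : k) :=
  pr_self f

section FreeModules

theorem isLocal_free {X : TwistedCenter k H α} (hX : X.pr 1 = 1) (hF : ∀ f : F, X.act f = 1) :
    (RightModule.free D.obj X).IsLocal := by
  refine RightModule.isLocal_free (hom_ext (TensorProduct.ext (LinearMap.ext fun x =>
    ext_single fun f => ?_)))
  refine (braiding_comp_braiding_tmul (LinearMap.congr_fun hX x) (obj_pr_single f)).trans ?_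
  rw [hF, Module.End.one_apply]
  rfl

theorem act_eq_self_of_pr_one (h : H) {a : D.obj.carrier} (ha : D.obj.pr 1 a = a) :
    D.obj.act h a = a := by
  suffices hpr : D.act h ∘ₗ pr F 1 = pr F 1 by
    rw [← ha]
    exact LinearMap.congr_fun hpr a
  refine ext_single fun f => ?_
  rw [LinearMap.comp_apply]
  by_cases hf : (f : H) = 1
  · obtain rfl : f = 1 := Subtype.ext hf
    have hpr : pr F 1 (Finsupp.single 1 (1 : k)) = Finsupp.single 1 1 := pr_self 1
    rw [hpr, act_single_one]
  · rw [pr_ne hf, map_zero]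

theorem act_eq_self_of_isSumOfRegular {M : RightModule D.obj} (hM : M.IsSumOfRegular) (h : H)
    {m : M.carrier.carrier} (hm : M.carrier.pr 1 m = m) : M.carrier.act h m = m := by
  obtain ⟨n, ι, π, -, -, hsum⟩ := hM
  have hm_eq : ∑ i, (ι i).hom.lin ((π i).hom.lin m) = m := by
    have hsum_lin := LinearMap.congr_fun (congrArg TwistedCenter.Hom.lin hsum) m
    rw [sum_lin, LinearMap.sum_apply] at hsum_lin
    exact hsum_lin
  calc M.carrier.act h m = ∑ i, (ι i).hom.lin (D.obj.act h ((π i).hom.lin m)) := by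
        conv_lhs => rw [← hm_eq, map_sum]
        exact Finset.sum_congr rfl fun i _ => ((ι i).hom.lin_act h _).symm
    _ = ∑ i, (ι i).hom.lin ((π i).hom.lin m) := Finset.sum_congr rfl fun i _ =>
        congrArg (ι i).hom.lin (act_eq_self_of_pr_one h (lin_homog (π i).hom hm))
    _ = m := hm_eq

theorem act_eq_self_of_isSumOfRegular_free {X : TwistedCenter k H α}
    (hX : (RightModule.free D.obj X).IsSumOfRegular) (h : H) {x : X.carrier} (hx : X.pr 1 x = x) :
    X.act h x = x := by
  classical
  have he : D.obj.pr 1 (Finsupp.single 1 1) = Finsupp.single 1 1 := obj_pr_single 1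
  have hx_tmul : (X.tensorObj D.obj).pr 1 (x ⊗ₜ Finsupp.single 1 1) = x ⊗ₜ Finsupp.single 1 1 := by
    simpa only [mul_one] using tensor_homog hx he
  have hact : X.act h x ⊗ₜ[k] Finsupp.single (1 : F) (1 : k) = x ⊗ₜ Finsupp.single 1 1 := by
    have hact_tmul := act_eq_self_of_isSumOfRegular hX h hx_tmul
    change tensorAct X D.obj h _ = _ at hact_tmul
    rw [tensorAct_tmul h hx he, NormCocycle.tensorTwist_one_left, Units.val_one, one_smul]
      at hact_tmul
    change X.act h x ⊗ₜ[k] D.act h _ = _ at hact_tmul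
    rwa [act_single_one] at hact_tmul
  simpa using DFunLike.congr_fun
    (congrArg (TensorProduct.finsuppScalarRight k k X.carrier F) hact) 1

end FreeModules

section LocalModules

variable (M : RightModule D.obj)

/-- Right multiplication by the basis vector `e_f`. -/
noncomputable def rightMul (f : F) : Module.End k M.carrier.carrier :=
  M.act.lin ∘ₗ (TensorProduct.mk k _ _).flip (Finsupp.single f 1)

variable {M} {X : TwistedCenter k H α} {g : H} {m : M.carrier.carrier} (f f' : F)

theorem rightMul_homog (hm : M.carrier.pr g m = m) :
    M.carrier.pr (g * f) (rightMul M f m) = rightMul M f m :=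
  lin_homog M.act (tensor_homog hm (obj_pr_single f))

theorem rightMul_rightMul (hm : M.carrier.pr g m = m) :
    rightMul M f' (rightMul M f m) =
      (((α.toFun g f f')⁻¹ * D.γ f f' : kˣ) : k) • rightMul M (f * f') m := by
  have hact := LinearMap.congr_fun (congrArg TwistedCenter.Hom.lin M.act_act)
    ((m ⊗ₜ Finsupp.single f (1 : k)) ⊗ₜ Finsupp.single f' (1 : k))
  refine hact.trans ?_
  change M.act.lin (TensorProduct.map LinearMap.id D.mulLin (assocLin M.carrier D.obj D.obj _)) = _
  rw [assocLin_tmul hm (obj_pr_single f) (obj_pr_single f'), map_smul, map_smul,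
    TensorProduct.map_tmul, mulLin_single, TensorProduct.tmul_smul, map_smul, smul_smul,
    Units.val_mul]
  rfl

theorem rightMul_one : rightMul M 1 = (D.γ 1 1 : k) • (1 : Module.End k M.carrier.carrier) := by
  ext m
  have hone := LinearMap.congr_fun (congrArg TwistedCenter.Hom.lin M.act_one)
    (m ⊗ₜ ULift.up (1 : k))
  change M.act.lin (m ⊗ₜ D.oneLin ⟨1⟩) = (1 : k) • m at hone
  rw [oneLin_up, one_smul, one_smul, TensorProduct.tmul_smul, map_smul] at hone
  rw [LinearMap.smul_apply, Module.End.one_apply, ← inv_smul_eq_iff₀ (Units.ne_zero _),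
    ← Units.val_inv_eq_inv_val]
  exact hone

theorem eq_zero_of_rightMul_eq_zero (hm : M.carrier.pr g m = m) (h0 : rightMul M f m = 0) :
    m = 0 := by
  have hmul := rightMul_rightMul f f⁻¹ hm
  rw [h0, map_zero, mul_inv_cancel, rightMul_one, LinearMap.smul_apply, smul_smul,
    ← Units.val_mul] at hmul
  exact (smul_eq_zero.1 hmul.symm).resolve_left (Units.ne_zero _)

theorem exists_rightMul_eq (hm : M.carrier.pr f m = m) :
    ∃ m₁, M.carrier.pr 1 m₁ = m₁ ∧ rightMul M f m₁ = m := by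
  let c : kˣ := (α.toFun f (f⁻¹ : F) f)⁻¹ * D.γ f⁻¹ f * D.γ 1 1
  have hmul : rightMul M f (rightMul M f⁻¹ m) = (c : k) • m := by
    rw [rightMul_rightMul f⁻¹ f hm, inv_mul_cancel, rightMul_one, LinearMap.smul_apply, smul_smul,
      ← Units.val_mul]
    rfl
  have hdeg : M.carrier.pr 1 (rightMul M f⁻¹ m) = rightMul M f⁻¹ m := by
    simpa using rightMul_homog f⁻¹ hm
  refine ⟨((c⁻¹ : kˣ) : k) • rightMul M f⁻¹ m, by rw [map_smul, hdeg], ?_⟩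
  rw [map_smul, hmul, smul_smul, Units.inv_mul, one_smul]

theorem act_eq_self_of_isLocal (hM : M.IsLocal) (hm : M.carrier.pr 1 m = m) :
    M.carrier.act f m = m := by
  have hlocal : rightMul M f (M.carrier.act f m) = rightMul M f m := by
    have hM_tmul := LinearMap.congr_fun (congrArg TwistedCenter.Hom.lin hM)
      (m ⊗ₜ Finsupp.single f (1 : k))
    rw [← Category.assoc] at hM_tmul
    exact (congrArg M.act.lin (braiding_comp_braiding_tmul hm (obj_pr_single f))).symm.trans hM_tmul
  rw [← sub_eq_zero]
  refine eq_zero_of_rightMul_eq_zero (g := 1) f ?_ (by rw [map_sub, hlocal, sub_self])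
  rw [map_sub, pr_one_act hm, hm]

theorem pr_freeLift [DecidableEq F] (hX : X.pr 1 = 1) (φ : X ⟶ M.carrier)
    (t : X.carrier ⊗[k] (F →₀ k)) :
    M.carrier.pr f ((RightModule.freeLift φ).hom.lin t) =
      rightMul M f (φ.lin (TensorProduct.finsuppScalarRight k k X.carrier F t f)) := by
  suffices hlin : M.carrier.pr f ∘ₗ (RightModule.freeLift φ).hom.lin =
      rightMul M f ∘ₗ φ.lin ∘ₗ Finsupp.lapply f ∘ₗ
        (TensorProduct.finsuppScalarRight k k X.carrier F).toLinearMap from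
    LinearMap.congr_fun hlin t
  refine TensorProduct.ext (LinearMap.ext fun x => ext_single fun f' => ?_)
  have hx := rightMul_homog f' (lin_homog φ (LinearMap.congr_fun hX x))
  rw [one_mul] at hx
  change M.carrier.pr f (rightMul M f' (φ.lin x)) = rightMul M f
    (φ.lin (TensorProduct.finsuppScalarRight k k X.carrier F (x ⊗ₜ Finsupp.single f' 1) f))
  rw [TensorProduct.finsuppScalarRight_apply_tmul_apply]
  by_cases hf : f' = f
  · rw [← hf, hx, Finsupp.single_eq_same, one_smul]
  · rw [TwistedCenter.pr_ne hx (Subtype.coe_ne_coe.2 (Ne.symm hf)),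
      Finsupp.single_eq_of_ne (Ne.symm hf), zero_smul, map_zero, map_zero]

theorem freeLift_injective (hX : X.pr 1 = 1) {φ : X ⟶ M.carrier}
    (hφ : Function.Injective φ.lin) : Function.Injective (RightModule.freeLift φ).hom.lin := by
  classical
  rw [injective_iff_map_eq_zero]
  intro t ht
  rw [← (TensorProduct.finsuppScalarRight k k X.carrier F).map_eq_zero_iff]
  ext f
  refine (map_eq_zero_iff φ.lin hφ).1 (eq_zero_of_rightMul_eq_zero f
    (lin_homog φ (LinearMap.congr_fun hX _)) ?_)
  rw [← pr_freeLift f hX, ht, map_zero]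

theorem freeLift_surjective (hF : F = ⊤) {φ : X ⟶ M.carrier}
    (hφ : LinearMap.range (M.carrier.pr 1) ≤ LinearMap.range φ.lin) :
    Function.Surjective (RightModule.freeLift φ).hom.lin := by
  intro m
  have hpr : ∀ g, M.carrier.pr g m ∈ LinearMap.range (RightModule.freeLift φ).hom.lin := by
    intro g
    let f : F := ⟨g, hF ▸ Subgroup.mem_top g⟩
    obtain ⟨m₁, hm₁, hm⟩ := exists_rightMul_eq f (M.carrier.pr_pr g m)
    obtain ⟨x, rfl⟩ := hφ (M.carrier.mem_range_pr_iff.2 hm₁)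
    exact ⟨x ⊗ₜ Finsupp.single f 1, hm⟩
  rw [← M.carrier.sum_pr m]
  exact Submodule.sum_mem _ fun g _ => hpr g

variable (M)

/-- Every module over `k[H, γ, ε]` is free on its degree one component. -/
noncomputable def freeDegreeOneIso (hF : F = ⊤) : RightModule.free D.obj M.carrier.degreeOne ≅ M :=
  have := isIso_of_bijective_lin (RightModule.freeLift M.carrier.degreeOneInclusion).hom
    ⟨freeLift_injective M.carrier.degreeOne_pr_one M.carrier.degreeOneInclusion_injective,
      freeLift_surjective hF M.carrier.range_degreeOneInclusion.ge⟩
  RightModule.isoOfIsIsoHom (RightModule.freeLift M.carrier.degreeOneInclusion)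

theorem isTrivial_degreeOne_of_isLocal (hF : F = ⊤) (hM : M.IsLocal) :
    M.carrier.degreeOne.IsTrivial where
  pr_one := M.carrier.degreeOne_pr_one
  act_eq_one g := LinearMap.ext fun m => Subtype.ext <|
    act_eq_self_of_isLocal ⟨g, hF ▸ Subgroup.mem_top g⟩ hM (M.carrier.mem_range_pr_iff.1 m.2)

end LocalModules

end EtaleDatum

theorem mainTheorem12_general {k : Type u} [Field k] {H : Type v} [Group H] [Fintype H]
    (α : NormCocycle k H) (F : Subgroup H) [F.Normal] (D : EtaleDatum α F) :
    IsLagrangian D.obj ↔ F = ⊤ := by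
  constructor
  · intro hL
    let ρ := Representation.ofMulAction k H (H ⧸ F)
    have hρ := TwistedCenter.ofRepresentation_pr_one α ρ
    have hlocal : (RightModule.free D.obj (TwistedCenter.ofRepresentation α ρ)).IsLocal :=
      EtaleDatum.isLocal_free hρ fun f =>
        ofMulAction_eq_one_iff.2 (forall_smul_quotient_eq_iff.2 f.2)
    refine eq_top_iff.2 fun h _ => ?_
    suffices hρh : ρ h = 1 from forall_smul_quotient_eq_iff.1 (ofMulAction_eq_one_iff.1 hρh)
    exact LinearMap.ext fun x => EtaleDatum.act_eq_self_of_isSumOfRegular_free (hL _ hlocal) h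
      (LinearMap.congr_fun hρ x)
  · intro hF M hM
    have hfree := RightModule.isSumOfRegular_free (A := D.obj)
      (EtaleDatum.isTrivial_degreeOne_of_isLocal M hF hM).isSumOfUnit
    exact hfree.of_iso (EtaleDatum.freeDegreeOneIso M hF)

theorem mainTheorem12 {k : Type u} [Field k] [CharZero k] {H : Type v} [Group H] [Fintype H]
    (α : NormCocycle k H) (F : Subgroup H) [F.Normal] (D : EtaleDatum α F) :
    IsLagrangian D.obj ↔ F = ⊤ :=
  mainTheorem12_general α F D
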